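/- Let $(X,d)$ be a geodesic metric space. A geodesic segment $\gamma$ is $r$-thin if for every geodesic quadrangle having $\gamma$ as a subsegment of one of its sides, the union of the other three sides meets the closed $r$-ball around the midpoint of $\gamma$. A contraction gauge is a non-decreasing function $K:[0,\infty)\to[0,\infty]$ with $K(r)\ge 4r+1$ for all $r$; it is full if it never takes the value $\infty$. A pair $(x,y)$ of points of $X$ is $K$-anti-contracting if $d(x,y)\ge 1$ and, for every $r\ge 0$ and every geodesic $\gamma$ from $x$ to $y$, no subsegment of $\gamma$ of length at least $K(r)$ is $r$-thin. The $K$-contraction space $\hat X_K$ is obtained from $X$ by gluing, for every $K$-anti-contracting pair $(x,y)$, the endpoints of an interval of length one to $x$ and $y$; it carries the induced path metric. The contraction space is $\hat X=\hat X_K$ for $K(r)=10r+1$, which is a full gauge. For $Y\subset X$ let $\pi_Y(x)$ be the set of points of $Y$ closest to $x$. The set $Y$ is $D$-contracting if $\operatorname{diam}\pi_Y(B_{d(x,Y)}(x))\le D$ for all $x\in X$, where $B_s(x)$ is the open ball. A geodesic ray is strongly contracting if its image is $D$-contracting for some $D\ge 0$. For $C\geq 1$, a bi-infinite $C$-quasi-geodesic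 is a continuous map $\gamma:\mathbb R\to X$ with $|t-s|/C-C\le d(\gamma(s),\gamma(t))\le C|t-s|+C$ for all $s,t$. An isometry $g$ of $X$ is a strongly contracting element if $n\mapsto g^nx$ is a quasi-isometric embedding of $\mathbb Z$ for some $x\in X$ and, for some $C$, $g$ stabilizes (the image of) a $C$-contracting bi-infinite $C$-quasi-geodesic. The density of $\mathrm{Isom}(X)\curvearrowright X$ is the infimum over $x\in X$ of the Hausdorff distance between $\mathrm{Isom}(X)\cdot x$ and $X$; it is at most $\rho$ if some orbit is $\rho$-dense. **Theorem.** For every $\rho\ge 0$ there is a constant $\Delta=\Delta(\rho)>0$, depending only on $\rho$, such that for every geodesic metric space $X$ on which $\mathrm{Isom}(X)$ acts with density at most $\rho$ the following holds. 1. For every contraction gauge $K$, either $\operatorname{diam}(\hat X_K)\le\Delta$ or $\hat X_K$ is unbounded. 2. For every full contraction gauge $K$ (in particular for $\hat X$): (a) $\hat X_K$ is unbounded if and only if $\mathrm{Isom}(X)$ contains a strongly contracting element; (b) if $X$ contains a strongly contracting geodesic ray, then $\hat X_K$ is unbounded; (c) if $X$ is proper and $\hat X_K$ is unbounded, then $X$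 contains a strongly contracting geodesic ray. In particular, if $X$ is proper, then $\hat X_K$ is unbounded if and only if $X$ contains a strongly contracting geodesic ray, equivalently if and only if $\mathrm{Isom}(X)$ contains a strongly contracting element. -/

import Mathlib

open Set Metric
open scoped NNReal ENNReal

universe u

noncomputable section

namespace Contraction

/-! ### Geodesics -/

/-- A geodesic segment in `X`, parametrised by arc length on `[0, length]`. The values of `toFun`
outside `[0, length]` carry no information. -/
structure GeodesicSegment (X : Type*) [MetricSpace X] where
  length : ℝ
  length_nonneg : 0 ≤ length
  toFun : ℝ → X
  dist_eq : ∀ s ∈ Icc 0 length, ∀ t ∈ Icc 0 length, dist (toFun s) (toFun t) = |s - t|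

namespace GeodesicSegment

variable {X : Type*} [MetricSpace X]

/-- The starting point of a geodesic segment. -/
def source (γ : GeodesicSegment X) : X := γ.toFun 0

/-- The endpoint of a geodesic segment. -/
def target (γ : GeodesicSegment X) : X := γ.toFun γ.length

/-- The midpoint of a geodesic segment. -/
def midpoint (γ : GeodesicSegment X) : X := γ.toFun (γ.length / 2)

/-- The set of points of a geodesic segment. -/
def carrier (γ : GeodesicSegment X) : Set X := γ.toFun '' Icc 0 γ.length

/-- `γ'` is a subsegment of `γ`. -/
def IsSubsegment (γ' γ : GeodesicSegment X) : Prop :=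
  ∃ a : ℝ, 0 ≤ a ∧ a + γ'.length ≤ γ.length ∧
    ∀ t ∈ Icc 0 γ'.length, γ'.toFun t = γ.toFun (a + t)

/-- `γ` is `r`-thin: for every geodesic quadrangle `(γ₁, γ₂, γ₃, γ₄)` such that `γ` is a subsegment
of `γ₁`, the union of the other three sides meets the closed `r`-ball around the midpoint
of `γ`. -/
def IsThin (r : ℝ) (γ : GeodesicSegment X) : Prop :=
  ∀ γ₁ γ₂ γ₃ γ₄ : GeodesicSegment X,
    γ₁.target = γ₂.source → γ₂.target = γ₃.source →
    γ₃.target = γ₄.source → γ₄.target = γ₁.source →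
    γ.IsSubsegment γ₁ →
    ((γ₂.carrier ∪ γ₃.carrier ∪ γ₄.carrier) ∩ closedBall γ.midpoint r).Nonempty

end GeodesicSegment

/-- `X` is a geodesic metric space: any two points are joined by a geodesic segment. -/
def IsGeodesicSpace (X : Type*) [MetricSpace X] : Prop :=
  ∀ x y : X, ∃ γ : GeodesicSegment X, γ.source = x ∧ γ.target = y

/-! ### Contraction gauges and anti-contracting pairs -/

/-- A contraction gauge: a non-decreasing function `K : [0, ∞) → [0, ∞]` with `K r ≥ 4 r + 1`. -/
structure ContractionGauge where
  toFun : ℝ≥0 → ℝ≥0∞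
  mono : Monotone toFun
  le_toFun : ∀ r : ℝ≥0, 4 * (r : ℝ≥0∞) + 1 ≤ toFun r

/-- A contraction gauge is full if it does not take the value `∞`. -/
def ContractionGauge.IsFull (K : ContractionGauge) : Prop := ∀ r : ℝ≥0, K.toFun r ≠ ∞

/-- The gauge `K r = 10 r + 1`. -/
def ContractionGauge.standard : ContractionGauge where
  toFun r := 10 * (r : ℝ≥0∞) + 1
  mono := fun r s h => by
    have : (r : ℝ≥0∞) ≤ s := by exact_mod_cast h
    dsimp only
    gcongr
  le_toFun := fun r => by
    gcongr
    norm_num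

theorem ContractionGauge.standard_isFull : ContractionGauge.standard.IsFull := fun _ =>
  ENNReal.add_ne_top.2 ⟨ENNReal.mul_ne_top (by norm_num) ENNReal.coe_ne_top, ENNReal.one_ne_top⟩

/-- `(x, y)` is `K`-anti-contracting: `d(x, y) ≥ 1`, and for every `r ≥ 0` and every geodesic from
`x` to `y`, no subsegment of length at least `K r` is `r`-thin. -/
def IsAntiContracting {X : Type*} [MetricSpace X] (K : ContractionGauge) (x y : X) : Prop :=
  1 ≤ dist x y ∧
    ∀ (r : ℝ≥0) (γ γ' : GeodesicSegment X), γ.source = x → γ.target = y →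
      γ'.IsSubsegment γ → K.toFun r ≤ ENNReal.ofReal γ'.length → ¬ γ'.IsThin r

/-- The type of `K`-anti-contracting pairs of points of `X`. -/
def AntiContractingPair (X : Type*) [MetricSpace X] (K : ContractionGauge) : Type _ :=
  {e : X × X // IsAntiContracting K e.1 e.2}

/-! ### The contraction space

`PreContractionSpace X K` is the disjoint union of `X` and of one copy of `[0, 1]` for every
`K`-anti-contracting pair. The distance `preDist` is the infimum of the lengths of chains that move
inside `X` or inside one of the intervals, and that may jump at no cost between an endpoint of an
interval and the point of `X` it is glued to. As `X` is a geodesic space, these are the lengths of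
the piecewise geodesic paths of the glued space, so that this is the induced path metric. Passing to
the quotient by the relation "distance zero" performs the gluing. -/

/-- The disjoint union of `X` and of a unit interval for every `K`-anti-contracting pair. -/
inductive PreContractionSpace (X : Type*) [MetricSpace X] (K : ContractionGauge)
  | pt (x : X) : PreContractionSpace X K
  | seg (e : AntiContractingPair X K) (t : Icc (0 : ℝ) 1) : PreContractionSpace X K

section

variable {X : Type*} [MetricSpace X] {K : ContractionGauge}

open PreContractionSpace

/-- `Step p q c`: one can go from `p` to `q` by an elementary move of length `c`. -/
inductive Step : PreContractionSpace X K → PreContractionSpace X K → ℝ → Prop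
  | space (x y : X) : Step (pt x) (pt y) (dist x y)
  | interval (e : AntiContractingPair X K) (s t : Icc (0 : ℝ) 1) :
      Step (seg e s) (seg e t) (dist s t)
  | enter_left (e : AntiContractingPair X K) : Step (pt e.1.1) (seg e 0) 0
  | leave_left (e : AntiContractingPair X K) : Step (seg e 0) (pt e.1.1) 0
  | enter_right (e : AntiContractingPair X K) : Step (pt e.1.2) (seg e 1) 0
  | leave_right (e : AntiContractingPair X K) : Step (seg e 1) (pt e.1.2) 0

/-- `Chain p q L`: there is a finite chain of elementary moves from `p` to `q` of total
length `L`. -/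
inductive Chain : PreContractionSpace X K → PreContractionSpace X K → ℝ → Prop
  | nil (p : PreContractionSpace X K) : Chain p p 0
  | cons {p q r : PreContractionSpace X K} {c L : ℝ} :
      Step p q c → Chain q r L → Chain p r (c + L)

theorem Step.nonneg {p q : PreContractionSpace X K} {c : ℝ} (h : Step p q c) : 0 ≤ c := by
  cases h <;> first | exact dist_nonneg | exact le_rfl

theorem Step.symm {p q : PreContractionSpace X K} {c : ℝ} (h : Step p q c) : Step q p c := by
  cases h with
  | space x y => rw [dist_comm]; exact .space y x
  | interval e s t => rw [dist_comm]; exact .interval e t s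
  | enter_left e => exact .leave_left e
  | leave_left e => exact .enter_left e
  | enter_right e => exact .leave_right e
  | leave_right e => exact .enter_right e

theorem Chain.nonneg {p q : PreContractionSpace X K} {L : ℝ} (h : Chain p q L) : 0 ≤ L := by
  induction h with
  | nil p => exact le_rfl
  | cons hs _ ih => exact add_nonneg hs.nonneg ih

theorem Step.chain {p q : PreContractionSpace X K} {c : ℝ} (h : Step p q c) : Chain p q c := by
  simpa using Chain.cons h (Chain.nil q)

theorem Chain.append {p q r : PreContractionSpace X K} {L M : ℝ} (h : Chain p q L)
    (h' : Chain q r M) : Chain p r (L + M) := by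
  induction h with
  | nil p => simpa using h'
  | cons hs _ ih => rw [add_assoc]; exact .cons hs (ih h')

theorem Chain.symm {p q : PreContractionSpace X K} {L : ℝ} (h : Chain p q L) : Chain q p L := by
  induction h with
  | nil p => exact .nil p
  | cons hs _ ih => rw [add_comm]; exact ih.append hs.symm.chain

theorem exists_chain_pt (p : PreContractionSpace X K) : ∃ (x : X) (L : ℝ), Chain p (pt x) L := by
  cases p with
  | pt x => exact ⟨x, 0, .nil _⟩
  | seg e t => exact ⟨e.1.1, _, (Step.interval e t 0).chain.append (Step.leave_left e).chain⟩

theorem exists_chain (p q : PreContractionSpace X K) : ∃ L : ℝ, Chain p q L := by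
  obtain ⟨x, L, hx⟩ := exists_chain_pt p
  obtain ⟨y, M, hy⟩ := exists_chain_pt q
  exact ⟨_, (hx.append (Step.space x y).chain).append hy.symm⟩

/-- The induced path (pseudo-)metric: the infimum of the lengths of chains from `p` to `q`. -/
def preDist (p q : PreContractionSpace X K) : ℝ := sInf {L : ℝ | Chain p q L}

theorem bddBelow_chain (p q : PreContractionSpace X K) : BddBelow {L : ℝ | Chain p q L} :=
  ⟨0, fun _ h => Chain.nonneg h⟩

theorem preDist_le {p q : PreContractionSpace X K} {L : ℝ} (h : Chain p q L) : preDist p q ≤ L :=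
  csInf_le (bddBelow_chain p q) h

instance : PseudoMetricSpace (PreContractionSpace X K) where
  dist := preDist
  dist_self p := le_antisymm (preDist_le (.nil p))
    (le_csInf (exists_chain p p) fun _ h => Chain.nonneg h)
  dist_comm p q := by
    have : {L : ℝ | Chain p q L} = {L : ℝ | Chain q p L} :=
      Set.ext fun _ => ⟨Chain.symm, Chain.symm⟩
    simp only [preDist, this]
  dist_triangle p q r := by
    refine le_of_forall_pos_le_add fun ε hε => ?_
    obtain ⟨L, hL, hL'⟩ := exists_lt_of_csInf_lt (exists_chain p q)
      (show preDist p q < preDist p q + ε / 2 by linarith)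
    obtain ⟨M, hM, hM'⟩ := exists_lt_of_csInf_lt (exists_chain q r)
      (show preDist q r < preDist q r + ε / 2 by linarith)
    have := preDist_le (Chain.append hL hM)
    linarith

end

/-- The `K`-contraction space of `X`. -/
def ContractionSpace (X : Type*) [MetricSpace X] (K : ContractionGauge) : Type _ :=
  SeparationQuotient (PreContractionSpace X K)

instance (X : Type*) [MetricSpace X] (K : ContractionGauge) : MetricSpace (ContractionSpace X K) :=
  inferInstanceAs (MetricSpace (SeparationQuotient (PreContractionSpace X K)))

/-! ### Strong contraction -/

/-- The closest point projection of `x` to the subset `Y`, as a set. -/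
def closestPoints {X : Type*} [MetricSpace X] (Y : Set X) (x : X) : Set X :=
  {p | p ∈ Y ∧ dist x p = infDist x Y}

/-- The subset `Y` is `D`-contracting: for every point `x`, the projection to `Y` of the open ball
around `x` of radius `d(x, Y)` has diameter at most `D`. -/
def IsContracting {X : Type*} [MetricSpace X] (D : ℝ) (Y : Set X) : Prop :=
  ∀ x : X, ediam (⋃ z ∈ ball x (infDist x Y), closestPoints Y z) ≤ ENNReal.ofReal D

/-- `X` contains a strongly contracting geodesic ray. -/
def HasStronglyContractingRay (X : Type*) [MetricSpace X] : Prop :=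
  ∃ γ : ℝ≥0 → X, Isometry γ ∧ ∃ D : ℝ, 0 ≤ D ∧ IsContracting D (range γ)

/-- `γ` is a bi-infinite `C`-quasi-geodesic. -/
def IsQuasiGeodesicLine {X : Type*} [MetricSpace X] (C : ℝ) (γ : ℝ → X) : Prop :=
  1 ≤ C ∧ Continuous γ ∧
    ∀ s t : ℝ, |t - s| / C - C ≤ dist (γ s) (γ t) ∧ dist (γ s) (γ t) ≤ C * |t - s| + C

/-- The isometry `g` is loxodromic: some orbit map `n ↦ gⁿ x` is a quasi-isometric embedding
of `ℤ`. -/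
def IsLoxodromic {X : Type*} [MetricSpace X] (g : X ≃ᵢ X) : Prop :=
  ∃ (x : X) (c : ℝ), 1 ≤ c ∧ ∀ m n : ℤ,
    |(m : ℝ) - n| / c - c ≤ dist ((g ^ m) x) ((g ^ n) x) ∧
      dist ((g ^ m) x) ((g ^ n) x) ≤ c * |(m : ℝ) - n| + c

/-- The isometry `g` is strongly contracting: it is loxodromic and for some `C` it stabilizes a
bi-infinite `C`-contracting `C`-quasi-geodesic. -/
def IsStronglyContractingElement {X : Type*} [MetricSpace X] (g : X ≃ᵢ X) : Prop :=
  IsLoxodromic g ∧ ∃ (C : ℝ) (γ : ℝ → X),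
    IsQuasiGeodesicLine C γ ∧ IsContracting C (range γ) ∧ g '' range γ = range γ

/-! ### Density of the isometry group -/

/-- The density of the action of `Isom(X)` on `X`: the infimum over `x` of the Hausdorff distance
between the orbit of `x` and `X`. It is `∞` if the action is not cobounded (or `X` is empty). -/
def isomDensity (X : Type*) [MetricSpace X] : ℝ≥0∞ :=
  ⨅ x : X, hausdorffEDist (range fun g : X ≃ᵢ X => g x) univ

/-- If some orbit of `Isom(X)` is `ρ`-dense, then the density is at most `ρ`. -/
theorem isomDensity_le {X : Type*} [MetricSpace X] {ρ : ℝ≥0} (x : X)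
    (h : ∀ y : X, ∃ g : X ≃ᵢ X, dist y (g x) ≤ ρ) : isomDensity X ≤ ρ := by
  refine (iInf_le _ x).trans (hausdorffEDist_le_of_mem_edist
    (fun z _ => ⟨z, mem_univ _, by simp⟩) fun y _ => ?_)
  obtain ⟨g, hg⟩ := h y
  exact ⟨g x, ⟨g, rfl⟩, by rw [edist_nndist]; exact_mod_cast hg⟩

end Contraction

end

/-! Everything is transferred to an integer-valued distance on X itself: `cdist` counts moves
between points that are `Near`, that is, at distance at most one or anti-contracting. Up to a factor
2 and additive constants it is the metric that X inherits from the contraction space, so boundedness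
and diameter can be read off it (`isBounded_contractionSpace_iff`, `ediam_contractionSpace_le`).

This distance is hyperbolic, with constants that depend neither on X nor on K. If a point m on a
side of a geodesic triangle is not near its closest point c on the other two sides, then [m, c]
contains an r-thin segment of length at least 4r + 1, and two quadrangles around it give a
contradiction. Repeated bisection turns these thin triangles into the statement that geodesics of X
stay close to shortest chains (`exists_cdist_geodesic_le`), and from there into the four-point
inequality with error 80 (`cdist_four_point`).

The uniform constant yields the dichotomy. A bounded hyperbolic space has a coarse centre, and a
cobounded action brings every point near the centre, so the diameter is controlled by the density
(`cdist_le_of_bounded`). In the unbounded case some isometry moves o so that the coarse distance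
from o to g² o exceeds that to g o by at least 161; the orbit of o is then a coarse line.

Coarse information returns to the metric of X through the bottleneck lemma
`exists_dist_le_of_not_near`: if no point of one geodesic is near a point of another, every geodesic
joining their outer ends passes close, in X, to the inner ends. Hence geodesics pass close to coarse
lines between the projections of their endpoints, so that coarse lines are strongly contracting
(`IsCoarseLine.exists_isContracting`). This gives the contracting axis, and in proper spaces a
contracting ray as a limit of segments.

Conversely, a geodesic whose endpoints project far apart on a contracting quasi-geodesic follows it,
and contains segments as long as desired that are thin for a radius independent of their length
(`IsContractingPath.exists_isThin`). A full gauge is finite at this radius, so anti-contracting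
pairs have nearby projections. The projection is then coarsely Lipschitz for `cdist`, and an
unbounded path makes `cdist` unbounded. Fullness enters only here. -/

namespace Contraction

/-! ### Operations on geodesic segments -/

namespace GeodesicSegment

variable {X : Type*} [MetricSpace X]

theorem zero_mem (γ : GeodesicSegment X) : (0 : ℝ) ∈ Icc 0 γ.length := ⟨le_rfl, γ.length_nonneg⟩

theorem length_mem (γ : GeodesicSegment X) : γ.length ∈ Icc 0 γ.length := ⟨γ.length_nonneg, le_rfl⟩

theorem apply_mem (γ : GeodesicSegment X) {t : ℝ} (h0 : 0 ≤ t) (h1 : t ≤ γ.length) :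
    γ.toFun t ∈ γ.carrier := ⟨t, ⟨h0, h1⟩, rfl⟩

theorem source_mem (γ : GeodesicSegment X) : γ.source ∈ γ.carrier := ⟨0, γ.zero_mem, rfl⟩

theorem target_mem (γ : GeodesicSegment X) : γ.target ∈ γ.carrier := ⟨_, γ.length_mem, rfl⟩

theorem dist_of_le (γ : GeodesicSegment X) {s t : ℝ} (h0 : 0 ≤ s) (hst : s ≤ t)
    (h1 : t ≤ γ.length) : dist (γ.toFun s) (γ.toFun t) = t - s := by
  rw [γ.dist_eq s ⟨h0, hst.trans h1⟩ t ⟨h0.trans hst, h1⟩, abs_sub_comm, abs_of_nonneg]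
  linarith

theorem dist_source (γ : GeodesicSegment X) {t : ℝ} (h0 : 0 ≤ t) (h1 : t ≤ γ.length) :
    dist γ.source (γ.toFun t) = t := by
  simpa [source] using γ.dist_of_le le_rfl h0 h1

theorem dist_target (γ : GeodesicSegment X) {t : ℝ} (h0 : 0 ≤ t) (h1 : t ≤ γ.length) :
    dist (γ.toFun t) γ.target = γ.length - t :=
  γ.dist_of_le h0 h1 le_rfl

theorem dist_source_target (γ : GeodesicSegment X) : dist γ.source γ.target = γ.length :=
  γ.dist_source γ.length_nonneg le_rfl

theorem continuousOn (γ : GeodesicSegment X) : ContinuousOn γ.toFun (Icc 0 γ.length) := by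
  refine (LipschitzOnWith.of_dist_le_mul (K := 1) fun s hs t ht => ?_).continuousOn
  rw [γ.dist_eq s hs t ht, Real.dist_eq]; simp

theorem isCompact_carrier (γ : GeodesicSegment X) : IsCompact γ.carrier :=
  isCompact_Icc.image_of_continuousOn γ.continuousOn

theorem dist_add_dist (γ : GeodesicSegment X) {m : X} (hm : m ∈ γ.carrier) :
    dist γ.source m + dist m γ.target = dist γ.source γ.target := by
  obtain ⟨t, ht, rfl⟩ := hm
  rw [γ.dist_source ht.1 ht.2, γ.dist_target ht.1 ht.2, γ.dist_source_target]; ring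

/-- The restriction of a geodesic segment to `[a, b]`. -/
def sub (γ : GeodesicSegment X) (a b : ℝ) (ha : 0 ≤ a) (hab : a ≤ b) (hb : b ≤ γ.length) :
    GeodesicSegment X where
  length := b - a
  length_nonneg := sub_nonneg.2 hab
  toFun t := γ.toFun (a + t)
  dist_eq s hs t ht := by
    rw [γ.dist_eq _ ⟨by linarith [hs.1], by linarith [hs.2]⟩ _
      ⟨by linarith [ht.1], by linarith [ht.2]⟩]
    congr 1; ring

section sub

variable (γ : GeodesicSegment X) {a b : ℝ} (ha : 0 ≤ a) (hab : a ≤ b) (hb : b ≤ γ.length)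

@[simp] theorem sub_source : (γ.sub a b ha hab hb).source = γ.toFun a := by simp [sub, source]

@[simp] theorem sub_target : (γ.sub a b ha hab hb).target = γ.toFun b := by simp [sub, target]

theorem sub_carrier_subset : (γ.sub a b ha hab hb).carrier ⊆ γ.carrier := by
  rintro _ ⟨t, ht, rfl⟩
  exact γ.apply_mem (by linarith [ht.1]) (by have := ht.2; simp only [sub] at this; linarith)

theorem mem_sub_carrier {t : ℝ} (h1 : a ≤ t) (h2 : t ≤ b) :
    γ.toFun t ∈ (γ.sub a b ha hab hb).carrier :=
  ⟨t - a, ⟨by linarith, by simp only [sub]; linarith⟩, by simp [sub]⟩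

theorem exists_of_mem_sub_carrier {m : X} (hm : m ∈ (γ.sub a b ha hab hb).carrier) :
    ∃ t, a ≤ t ∧ t ≤ b ∧ γ.toFun t = m := by
  obtain ⟨t, ht, rfl⟩ := hm
  exact ⟨a + t, by linarith [ht.1], by have := ht.2; simp only [sub] at this; linarith, rfl⟩

theorem sub_isSubsegment : (γ.sub a b ha hab hb).IsSubsegment γ :=
  ⟨a, ha, by simp only [sub]; linarith, fun _ _ => rfl⟩

end sub

/-- The reversed geodesic segment. -/
def rev (γ : GeodesicSegment X) : GeodesicSegment X where
  length := γ.length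
  length_nonneg := γ.length_nonneg
  toFun t := γ.toFun (γ.length - t)
  dist_eq s hs t ht := by
    rw [γ.dist_eq _ ⟨by linarith [hs.2], by linarith [hs.1]⟩ _
      ⟨by linarith [ht.2], by linarith [ht.1]⟩, abs_sub_comm s t]
    congr 1; ring

@[simp] theorem rev_source (γ : GeodesicSegment X) : γ.rev.source = γ.target := by
  simp [rev, source, target]

@[simp] theorem rev_target (γ : GeodesicSegment X) : γ.rev.target = γ.source := by
  simp [rev, source, target]

@[simp] theorem rev_carrier (γ : GeodesicSegment X) : γ.rev.carrier = γ.carrier := by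
  ext m; constructor
  · rintro ⟨t, ht, rfl⟩
    exact γ.apply_mem (sub_nonneg.2 ht.2) (by linarith [ht.1])
  · rintro ⟨t, ht, rfl⟩
    exact ⟨γ.length - t, ⟨sub_nonneg.2 ht.2, by simp only [rev]; linarith [ht.1]⟩, by simp [rev]⟩

/-- The constant geodesic segment. -/
def point (x : X) : GeodesicSegment X where
  length := 0
  length_nonneg := le_rfl
  toFun _ := x
  dist_eq s hs t ht := by
    have h1 : s = 0 := le_antisymm hs.2 hs.1
    have h2 : t = 0 := le_antisymm ht.2 ht.1
    simp [h1, h2]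

@[simp] theorem point_source (x : X) : (point x).source = x := rfl
@[simp] theorem point_target (x : X) : (point x).target = x := rfl
theorem mem_point {x m : X} (h : m ∈ (point x).carrier) : m = x := by
  obtain ⟨t, _, rfl⟩ := h; rfl

theorem exists_split (γ : GeodesicSegment X) {m : X} (hm : m ∈ γ.carrier) :
    ∃ α β : GeodesicSegment X, α.source = γ.source ∧ α.target = m ∧ β.source = m ∧
      β.target = γ.target ∧ α.carrier ⊆ γ.carrier ∧ β.carrier ⊆ γ.carrier := by
  obtain ⟨t, ht, rfl⟩ := hm
  exact ⟨γ.sub 0 t le_rfl ht.1 ht.2, γ.sub t γ.length ht.1 ht.2 le_rfl, γ.sub_source .., by simp,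
    by simp, γ.sub_target .., sub_carrier_subset .., sub_carrier_subset ..⟩

/-- The concatenation of two geodesic segments whose lengths add up to the distance between
the outer endpoints. -/
noncomputable def concat (α β : GeodesicSegment X) (h : α.target = β.source)
    (hd : α.length + β.length ≤ dist α.source β.target) : GeodesicSegment X where
  length := α.length + β.length
  length_nonneg := add_nonneg α.length_nonneg β.length_nonneg
  toFun t := if t ≤ α.length then α.toFun t else β.toFun (t - α.length)
  dist_eq := by
    have key : ∀ s ∈ Icc 0 (α.length + β.length), ∀ t ∈ Icc 0 (α.length + β.length), s ≤ t →
        dist (if s ≤ α.length then α.toFun s else β.toFun (s - α.length))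
          (if t ≤ α.length then α.toFun t else β.toFun (t - α.length)) = t - s := by
      intro s hs t ht hst
      split_ifs with h1 h2 h2
      · exact α.dist_of_le hs.1 hst h2
      · push Not at h2
        have e1 := α.dist_source hs.1 h1
        have e2 := α.dist_target hs.1 h1
        have e3 := β.dist_source (t := t - α.length) (by linarith) (by linarith [ht.2])
        have e4 := β.dist_target (t := t - α.length) (by linarith) (by linarith [ht.2])
        rw [← h] at e3
        apply le_antisymm
        · linarith [dist_triangle (α.toFun s) α.target (β.toFun (t - α.length))]
        · linarith [dist_triangle4 α.source (α.toFun s) (β.toFun (t - α.length)) β.target]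
      · exact absurd (hst.trans h2) h1
      · push Not at h1 h2
        rw [β.dist_of_le (by linarith) (by linarith) (by linarith [ht.2])]; ring
    intro s hs t ht
    rcases le_total s t with h' | h'
    · rw [key s hs t ht h', abs_sub_comm, abs_of_nonneg (by linarith)]
    · rw [dist_comm, key t ht s hs h', abs_of_nonneg (by linarith)]

section concat

variable (α β : GeodesicSegment X) (h : α.target = β.source)
    (hd : α.length + β.length ≤ dist α.source β.target)

theorem concat_source : (α.concat β h hd).source = α.source := by
  simp [concat, source, α.length_nonneg]

theorem concat_target : (α.concat β h hd).target = β.target := by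
  simp only [concat, target]
  split_ifs with h1
  · have : β.length = 0 := by linarith [β.length_nonneg]
    simpa [this, target, source] using h
  · simp

theorem isSubsegment_concat_left : α.IsSubsegment (α.concat β h hd) :=
  ⟨0, le_rfl, by simp [concat, β.length_nonneg], fun t ht => by simp [concat, ht.2]⟩

theorem isSubsegment_concat_right : β.IsSubsegment (α.concat β h hd) := by
  refine ⟨α.length, α.length_nonneg, le_rfl, fun t ht => ?_⟩
  simp only [concat]
  split_ifs with h1
  · have : t = 0 := by linarith [ht.1]
    subst this
    simpa [target, source] using h.symm
  · simp

end concat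

theorem IsSubsegment.trans {α β γ : GeodesicSegment X} (h1 : α.IsSubsegment β)
    (h2 : β.IsSubsegment γ) : α.IsSubsegment γ := by
  obtain ⟨a, ha, hal, hat⟩ := h1
  obtain ⟨b, hb, hbl, hbt⟩ := h2
  refine ⟨b + a, by positivity, by linarith, fun t ht => ?_⟩
  rw [hat t ht, hbt _ ⟨by linarith [ht.1], by linarith [ht.2]⟩, add_assoc]

/-- The image of a geodesic segment under an isometry. -/
def map {Y : Type*} [MetricSpace Y] (f : X → Y) (hf : Isometry f) (γ : GeodesicSegment X) :
    GeodesicSegment Y where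
  length := γ.length
  length_nonneg := γ.length_nonneg
  toFun t := f (γ.toFun t)
  dist_eq s hs t ht := by rw [hf.dist_eq, γ.dist_eq s hs t ht]

end GeodesicSegment

/-- A discrete intermediate value theorem: a real function on `[0, l]` that varies by at most `J`
on intervals of length one comes within `J` of each intermediate value. -/
theorem exists_abs_sub_le_of_le_of_le {φ : ℝ → ℝ} {l J u : ℝ} (hl : 0 ≤ l)
    (hφ : ∀ s ∈ Icc 0 l, ∀ t ∈ Icc 0 l, |s - t| ≤ 1 → |φ s - φ t| ≤ J)
    (h0 : φ 0 ≤ u) (h1 : u ≤ φ l) : ∃ t ∈ Icc 0 l, |φ t - u| ≤ J := by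
  classical
  -- Sampling at integer times truncated at l; the first sample that reaches u overshoots it by at
  -- most J.
  have hex : ∃ k : ℕ, u ≤ φ (min k l) := by
    obtain ⟨k, hk⟩ := exists_nat_ge l
    exact ⟨k, by rwa [min_eq_right hk]⟩
  have hmem : ∀ k : ℕ, min (k : ℝ) l ∈ Icc 0 l := fun k =>
    ⟨le_min k.cast_nonneg hl, min_le_right _ _⟩
  refine ⟨min (Nat.find hex : ℝ) l, hmem _, ?_⟩
  have h2 := Nat.find_spec hex
  rcases Nat.eq_zero_or_pos (Nat.find hex) with h | h
  · have hJ : 0 ≤ J := (abs_nonneg _).trans (hφ 0 ⟨le_rfl, hl⟩ 0 ⟨le_rfl, hl⟩ (by simp))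
    rw [h] at h2 ⊢
    simp only [Nat.cast_zero, min_eq_left hl] at h2 ⊢
    rw [le_antisymm h0 h2]; simpa using hJ
  · have h3 := Nat.find_min hex (Nat.sub_lt h one_pos)
    push Not at h3
    have h4 := hφ _ (hmem (Nat.find hex)) _ (hmem (Nat.find hex - 1)) (by
      have : ((Nat.find hex - 1 : ℕ) : ℝ) = (Nat.find hex : ℝ) - 1 := by
        rw [Nat.cast_sub h]; simp
      rw [this]
      refine (abs_min_sub_min_le_max _ _ _ _).trans ?_
      simp)
    rw [abs_le] at h4 ⊢
    constructor <;> linarith [h4.1, h4.2]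

/-! ### Near points -/

variable {X : Type*} [MetricSpace X] {K : ContractionGauge}

/-- Two points are near if their distance is at most one or if they form an anti-contracting pair,
in one of the two orders. -/
def Near (K : ContractionGauge) (x y : X) : Prop :=
  dist x y ≤ 1 ∨ IsAntiContracting K x y ∨ IsAntiContracting K y x

theorem Near.symm {x y : X} (h : Near K x y) : Near K y x := by
  rcases h with h | h | h
  · exact .inl (by rwa [dist_comm])
  · exact .inr (.inr h)
  · exact .inr (.inl h)

theorem Near.refl (x : X) : Near K x x := .inl (by simp)

/-- Of the gauge, only the lower bound 4r + 1 survives here. This is why all hyperbolicity constants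
below are independent of K. -/
theorem exists_isThin_of_not_near {x y : X} (h : ¬ Near K x y) :
    ∃ (r : ℝ≥0) (γ γ' : GeodesicSegment X), γ.source = x ∧ γ.target = y ∧ γ'.IsSubsegment γ ∧
      4 * (r : ℝ) + 1 ≤ γ'.length ∧ γ'.IsThin r := by
  simp only [Near, not_or, not_le] at h
  have h2 := h.2.1
  simp only [IsAntiContracting, not_and, not_forall, not_not] at h2
  obtain ⟨r, γ, γ', h3, h4, h5, h6, h7⟩ := h2 h.1.le
  refine ⟨r, γ, γ', h3, h4, h5, ?_, h7⟩
  have h8 := (K.le_toFun r).trans h6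
  rw [← ENNReal.ofReal_coe_nnreal,
    show (4 * ENNReal.ofReal (r : ℝ) + 1 : ℝ≥0∞) = ENNReal.ofReal (4 * r + 1) by
      rw [ENNReal.ofReal_add (by positivity) zero_le_one, ENNReal.ofReal_mul (by norm_num)]; simp,
    ENNReal.ofReal_le_ofReal_iff γ'.length_nonneg] at h8
  exact h8

/-- As m lies between x and y, every geodesic from x to m prolongs to one from x to y, so a long
thin subsegment of the former would be one of the latter. -/
theorem IsAntiContracting.left {x y m : X} (h : IsAntiContracting K x y) (hm : 1 ≤ dist x m)
    (hd : dist x m + dist m y = dist x y) (hX : IsGeodesicSpace X) : IsAntiContracting K x m := by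
  refine ⟨hm, fun r γ γ' h1 h2 h3 h4 => ?_⟩
  obtain ⟨β, hβ1, hβ2⟩ := hX m y
  have e1 := γ.dist_source_target
  have e2 := β.dist_source_target
  rw [h1, h2] at e1
  rw [hβ1, hβ2] at e2
  have hh : γ.target = β.source := by rw [h2, hβ1]
  have hd' : γ.length + β.length ≤ dist γ.source β.target := by rw [h1, hβ2]; linarith
  exact h.2 r (γ.concat β hh hd') γ' (by rw [γ.concat_source, h1]) (by rw [γ.concat_target, hβ2])
    (h3.trans (γ.isSubsegment_concat_left β hh hd')) h4

theorem IsAntiContracting.right {x y m : X} (h : IsAntiContracting K x y) (hm : 1 ≤ dist m y)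
    (hd : dist x m + dist m y = dist x y) (hX : IsGeodesicSpace X) : IsAntiContracting K m y := by
  refine ⟨hm, fun r γ γ' h1 h2 h3 h4 => ?_⟩
  obtain ⟨β, hβ1, hβ2⟩ := hX x m
  have e1 := γ.dist_source_target
  have e2 := β.dist_source_target
  rw [h1, h2] at e1
  rw [hβ1, hβ2] at e2
  have hh : β.target = γ.source := by rw [h1, hβ2]
  have hd' : β.length + γ.length ≤ dist β.source γ.target := by rw [h2, hβ1]; linarith
  exact h.2 r (β.concat γ hh hd') γ' (by rw [β.concat_source, hβ1])
    (by rw [β.concat_target, h2]) (h3.trans (β.isSubsegment_concat_right γ hh hd')) h4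

theorem Near.left {x y m : X} (h : Near K x y) (hd : dist x m + dist m y = dist x y)
    (hX : IsGeodesicSpace X) : Near K x m := by
  rcases le_total (dist x m) 1 with h1 | h1
  · exact .inl h1
  rcases h with h | h | h
  · exact .inl (by linarith [dist_nonneg (x := m) (y := y)])
  · exact .inr (.inl (h.left h1 hd hX))
  · exact .inr (.inr (h.right (by rwa [dist_comm])
      (by rw [dist_comm y m, dist_comm m x, dist_comm y x]; linarith) hX))

/-! ### The coarse distance -/

/-- The graph on `X` whose edges are the pairs of near points. -/
def nearGraph (X : Type*) [MetricSpace X] (K : ContractionGauge) : SimpleGraph X where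
  Adj x y := x ≠ y ∧ Near K x y
  symm := ⟨fun _ _ h => ⟨h.1.symm, h.2.symm⟩⟩
  loopless := ⟨fun _ h => h.1 rfl⟩

/-- The coarse distance: the least number of moves between near points. -/
noncomputable def cdist (K : ContractionGauge) (x y : X) : ℕ := (nearGraph X K).dist x y

theorem cdist_self (x : X) : cdist K x x = 0 := SimpleGraph.dist_self

theorem cdist_comm (x y : X) : cdist K x y = cdist K y x := SimpleGraph.dist_comm

theorem Near.reachable {x y : X} (h : Near K x y) : (nearGraph X K).Reachable x y := by
  rcases eq_or_ne x y with rfl | hne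
  · exact .refl _
  · exact SimpleGraph.Adj.reachable (G := nearGraph X K) ⟨hne, h⟩

theorem Near.cdist_le_one {x y : X} (h : Near K x y) : cdist K x y ≤ 1 := by
  rcases eq_or_ne x y with rfl | hne
  · simp [cdist_self]
  · exact (SimpleGraph.dist_eq_one_iff_adj (G := nearGraph X K).2 ⟨hne, h⟩).le

theorem reachable_of_chain {f : ℕ → X} (hf : ∀ i, Near K (f i) (f (i + 1))) (n : ℕ) :
    (nearGraph X K).Reachable (f 0) (f n) := by
  induction n with
  | zero => exact .refl _
  | succ n ih => exact ih.trans (hf n).reachable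

theorem near_chain_of_segment (γ : GeodesicSegment X) (i : ℕ) :
    Near K (γ.toFun (min i γ.length)) (γ.toFun (min (i + 1 : ℕ) γ.length)) := by
  left
  rw [γ.dist_of_le (le_min i.cast_nonneg γ.length_nonneg) (by push_cast; gcongr; simp)
    (min_le_right _ _)]
  have := abs_min_sub_min_le_max ((i + 1 : ℕ) : ℝ) γ.length i γ.length
  simp only [Nat.cast_add, Nat.cast_one, add_sub_cancel_left, abs_one, sub_self, abs_zero,
    zero_le_one, sup_of_le_left] at this ⊢
  exact (le_abs_self _).trans this

theorem nearGraph_connected (hX : IsGeodesicSpace X) (x y : X) :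
    (nearGraph X K).Reachable x y := by
  obtain ⟨γ, rfl, rfl⟩ := hX x y
  obtain ⟨n, hn⟩ := exists_nat_ge γ.length
  have := reachable_of_chain (K := K) (near_chain_of_segment γ) n
  simpa [min_eq_right hn, γ.length_nonneg, GeodesicSegment.source, GeodesicSegment.target]
    using this

theorem cdist_triangle (hX : IsGeodesicSpace X) (x y z : X) :
    cdist K x z ≤ cdist K x y + cdist K y z :=
  haveI : Nonempty X := ⟨x⟩
  SimpleGraph.Connected.dist_triangle ⟨nearGraph_connected hX⟩

theorem cdist_le_of_chain (hX : IsGeodesicSpace X) {f : ℕ → X}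
    (hf : ∀ i, Near K (f i) (f (i + 1))) {i j : ℕ} (hij : i ≤ j) :
    cdist K (f i) (f j) ≤ j - i := by
  induction j, hij using Nat.le_induction with
  | base => simp [cdist_self]
  | succ j hij ih =>
    have := cdist_triangle (K := K) hX (f i) (f j) (f (j + 1))
    have := (hf j).cdist_le_one
    omega

theorem exists_chain_cdist (hX : IsGeodesicSpace X) (x y : X) :
    ∃ f : ℕ → X, f 0 = x ∧ f (cdist K x y) = y ∧ ∀ i, Near K (f i) (f (i + 1)) := by
  obtain ⟨w, hw⟩ := (nearGraph_connected (K := K) hX x y).exists_walk_length_eq_dist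
  refine ⟨w.getVert, by simp, by rw [cdist, ← hw]; simp, fun i => ?_⟩
  rcases lt_or_ge i w.length with h | h
  · exact (w.adj_getVert_succ h).2
  · rw [w.getVert_of_length_le h, w.getVert_of_length_le (by omega)]; exact .refl _

theorem cdist_le_dist_add_one (hX : IsGeodesicSpace X) (x y : X) :
    (cdist K x y : ℝ) ≤ dist x y + 1 := by
  obtain ⟨γ, rfl, rfl⟩ := hX x y
  have := cdist_le_of_chain (K := K) hX (near_chain_of_segment γ) (Nat.zero_le ⌈γ.length⌉₊)
  simp only [CharP.cast_eq_zero, min_eq_left γ.length_nonneg, min_eq_right (Nat.le_ceil γ.length),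
    tsub_zero] at this
  rw [γ.dist_source_target]
  exact (Nat.cast_le.2 this).trans (Nat.ceil_lt_add_one γ.length_nonneg).le

/-! ### Thin triangles -/

/-- A long r-thin segment on [m, c] has its midpoint too far from β and δ, by minimality of c. In
the two quadrangles cut off by [m, c], the thinness must therefore be realised on the two halves of
α. The two points found there are 2r-close to each other, yet on opposite sides of m and each too
far from m. -/
theorem near_of_isMinOn {α β δ : GeodesicSegment X} {m c : X}
    (h1 : α.target = β.source) (h2 : β.target = δ.source) (h3 : δ.target = α.source)
    (hm : m ∈ α.carrier) (hc : c ∈ β.carrier)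
    (hmin : ∀ e ∈ β.carrier ∪ δ.carrier, dist m c ≤ dist m e) : Near K m c := by
  by_contra hn
  obtain ⟨r, γ, γ', hγ1, hγ2, ⟨a, ha, hal, hat⟩, hL, hthin⟩ := exists_isThin_of_not_near hn
  have hr := r.2
  have hm' : γ'.midpoint = γ.toFun (a + γ'.length / 2) :=
    hat _ ⟨by linarith [γ'.length_nonneg], by linarith [γ'.length_nonneg]⟩
  have d1 : dist m γ'.midpoint = a + γ'.length / 2 := by
    rw [hm', ← hγ1, γ.dist_source (by linarith [γ'.length_nonneg]) (by linarith)]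
  have d2 : dist m c = γ.length := by rw [← hγ1, ← hγ2, γ.dist_source_target]
  obtain ⟨α₁, α₂, p1, p2, p3, p4, p5, p6⟩ := α.exists_split hm
  obtain ⟨β₁, β₂, q1, q2, q3, q4, q5, q6⟩ := β.exists_split hc
  have hβ : ∀ e ∈ β.carrier ∪ δ.carrier, ¬ dist e γ'.midpoint ≤ r := fun e he he' => by
    have := hmin e he
    linarith [dist_triangle_right m e γ'.midpoint]
  -- [m, c] cuts the triangle into a triangle, read as a quadrangle with a constant fourth side, and
  -- a genuine quadrangle.
  obtain ⟨e, he, he'⟩ := hthin γ β₁.rev α₂.rev (GeodesicSegment.point m)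
    (by simp [hγ2, q2]) (by simp [q1, p4, h1]) (by simp [p3]) (by simp [hγ1])
    ⟨a, ha, hal, hat⟩
  obtain ⟨e₂, he₂, he₂'⟩ := hthin γ β₂ δ α₁ (by simp [hγ2, q3]) (by simp [q4, h2])
    (by simp [p1, h3]) (by simp [hγ1, p2]) ⟨a, ha, hal, hat⟩
  rw [mem_closedBall] at he' he₂'
  have k1 : e ∈ α₂.carrier := by
    rcases he with (he | he) | he
    · exact absurd he' (hβ e (.inl (q5 (by simpa using he))))
    · simpa using he
    · rw [GeodesicSegment.mem_point he, ← p3]; exact α₂.source_mem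
  have k2 : e₂ ∈ α₁.carrier := by
    rcases he₂ with (he | he) | he
    · exact absurd he₂' (hβ e₂ (.inl (q6 he)))
    · exact absurd he₂' (hβ e₂ (.inr he))
    · exact he
  have l1 := α₂.dist_add_dist k1
  have l2 := α₁.dist_add_dist k2
  have l3 := α.dist_add_dist hm
  rw [p3, p4] at l1
  rw [p1, p2] at l2
  linarith [dist_triangle4 α.source e₂ e α.target, dist_triangle_right e₂ e γ'.midpoint,
    dist_triangle m e γ'.midpoint, dist_triangle m e₂ γ'.midpoint, dist_comm m e₂,
    dist_comm m e]

theorem exists_near_of_triangle {α β δ : GeodesicSegment X} {m : X}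
    (h1 : α.target = β.source) (h2 : β.target = δ.source) (h3 : δ.target = α.source)
    (hm : m ∈ α.carrier) : ∃ c ∈ β.carrier ∪ δ.carrier, Near K m c := by
  obtain ⟨c, hc, hmin⟩ := (β.isCompact_carrier.union δ.isCompact_carrier).exists_isMinOn
    ⟨_, .inl β.source_mem⟩ (f := fun e => dist m e) (by fun_prop)
  refine ⟨c, hc, ?_⟩
  rcases hc with hc | hc
  · exact near_of_isMinOn h1 h2 h3 hm hc hmin
  · refine near_of_isMinOn (α := α.rev) (β := δ.rev) (δ := β.rev) (by simp [h3]) (by simp [h2])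
      (by simp [h1]) (by simpa) (by simpa) ?_
    intro e he
    exact hmin (by simpa [or_comm] using he)

/-! ### The bottleneck lemma -/

/-- A pair (c, c') minimising the weighted sum below is joined by a geodesic with a long r-thin
segment. Minimality keeps α and β away from the midpoint of that segment, so σ must come close to
it. -/
theorem exists_dist_le_of_not_near {α β σ : GeodesicSegment X}
    (hp : σ.source = α.source) (hq : σ.target = β.target)
    (hn : ∀ c ∈ α.carrier, ∀ c' ∈ β.carrier, ¬ Near K c c') :
    ∃ e ∈ σ.carrier, dist e α.target ≤ 5 * dist α.target β.source := by
  obtain ⟨⟨c, c'⟩, ⟨hc, hc'⟩, hmin⟩ :=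
    (α.isCompact_carrier.prod β.isCompact_carrier).exists_isMinOn
      ⟨(α.target, β.source), α.target_mem, β.source_mem⟩
      (f := fun z : X × X => 3 * dist z.1 z.2 + dist z.1 α.target + dist z.2 β.source)
      (by fun_prop)
  have hmin' : ∀ z ∈ α.carrier, ∀ z' ∈ β.carrier, 3 * dist c c' + dist c α.target +
      dist c' β.source ≤ 3 * dist z z' + dist z α.target + dist z' β.source :=
    fun z hz z' hz' => hmin (show (z, z') ∈ α.carrier ×ˢ β.carrier from ⟨hz, hz'⟩)
  obtain ⟨r, γ, γ', hγ1, hγ2, ⟨a, ha, hal, hat⟩, hL, hthin⟩ :=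
    exists_isThin_of_not_near (hn c hc c' hc')
  have hr : (0 : ℝ) ≤ r := r.2
  have hm' : γ'.midpoint = γ.toFun (a + γ'.length / 2) :=
    hat _ ⟨by linarith [γ'.length_nonneg], by linarith [γ'.length_nonneg]⟩
  have d1 : dist c γ'.midpoint = a + γ'.length / 2 := by
    rw [hm', ← hγ1, γ.dist_source (by linarith [γ'.length_nonneg]) (by linarith)]
  have d2 : dist γ'.midpoint c' = γ.length - (a + γ'.length / 2) := by
    rw [hm', ← hγ2, γ.dist_target (by linarith [γ'.length_nonneg]) (by linarith)]
  have d3 : dist c c' = γ.length := by rw [← hγ1, ← hγ2, γ.dist_source_target]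
  obtain ⟨α₁, α₂, p1, p2, p3, p4, p5, p6⟩ := α.exists_split hc
  obtain ⟨β₁, β₂, q1, q2, q3, q4, q5, q6⟩ := β.exists_split hc'
  obtain ⟨e, he, he'⟩ := hthin γ β₂ σ.rev α₁
    (by simp [hγ2, q3]) (by simp [q4, hq]) (by simp [p1, hp]) (by simp [hγ1, p2])
    ⟨a, ha, hal, hat⟩
  rw [mem_closedBall] at he'
  have h0 := hmin' _ α.target_mem _ β.source_mem
  simp only [dist_self, add_zero] at h0
  rcases he with (he | he) | he
  · have := hmin' c hc e (q6 he)
    -- Replacing c' by e saves twice the distance from the midpoint to c', which is at least 4r + 1,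
    -- and costs at most 4r. The weight 3 and the bound 4r + 1 on the gauge are matched for this.
    linarith [dist_triangle c γ'.midpoint e, dist_comm e γ'.midpoint, dist_triangle e c' β.source,
      dist_triangle e γ'.midpoint c']
  · refine ⟨e, by simpa using he, ?_⟩
    linarith [dist_triangle4 e γ'.midpoint c α.target, dist_comm c γ'.midpoint,
      dist_nonneg (x := c) (y := α.target), dist_nonneg (x := c') (y := β.source)]
  · have := hmin' e (p5 he) c' hc'
    linarith [dist_triangle e γ'.midpoint c', dist_triangle e c α.target,
      dist_triangle e γ'.midpoint c, dist_comm c γ'.midpoint]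

/-! ### Hyperbolicity of the coarse distance -/

/-- Bisection: each thin triangle over the middle point of the chain halves the chain and costs one
move, whence a bound logarithmic in the number of moves. -/
theorem exists_cdist_chain_le (hX : IsGeodesicSpace X) {f : ℕ → X}
    (hf : ∀ i, Near K (f i) (f (i + 1))) (k : ℕ) :
    ∀ {i j : ℕ} {α : GeodesicSegment X} {m : X}, i ≤ j → j ≤ i + 2 ^ k → α.source = f i →
      α.target = f j → m ∈ α.carrier → ∃ l, i ≤ l ∧ l ≤ j ∧ cdist K m (f l) ≤ k + 1 := by
  induction k with
  | zero =>
    intro i j α m hij hj h1 h2 hm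
    refine ⟨i, le_rfl, hij, ?_⟩
    have hd := α.dist_add_dist hm
    rw [h1, h2] at hd
    have hn : Near K (f i) (f j) := by
      rcases Nat.lt_or_ge i j with h | h
      · obtain rfl : j = i + 1 := by simp at hj; omega
        exact hf i
      · obtain rfl : i = j := le_antisymm hij h
        exact .refl _
    simpa using (hn.left hd hX).symm.cdist_le_one
  | succ k ih =>
    intro i j α m hij hj h1 h2 hm
    rw [pow_succ] at hj
    obtain ⟨β, hβ1, hβ2⟩ := hX (f j) (f ((i + j) / 2))
    obtain ⟨δ, hδ1, hδ2⟩ := hX (f ((i + j) / 2)) (f i)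
    obtain ⟨c, hc, hmc⟩ := exists_near_of_triangle (K := K) (by rw [h2, hβ1]) (by rw [hβ2, hδ1])
      (by rw [hδ2, h1]) hm
    have h1' := hmc.cdist_le_one
    rcases hc with hc | hc
    · obtain ⟨l, hl1, hl2, hl3⟩ := ih (i := (i + j) / 2) (j := j) (α := β.rev) (m := c) (by omega)
        (by omega) (by simp [hβ2]) (by simp [hβ1]) (by simpa)
      have := cdist_triangle (K := K) hX m c (f l)
      exact ⟨l, by omega, hl2, by omega⟩
    · obtain ⟨l, hl1, hl2, hl3⟩ := ih (i := i) (j := (i + j) / 2) (α := δ.rev) (m := c) (by omega)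
        (by omega) (by simp [hδ2]) (by simp [hδ1]) (by simpa)
      have := cdist_triangle (K := K) hX m c (f l)
      exact ⟨l, hl1, by omega, by omega⟩

theorem exists_cdist_le_of_segment (hX : IsGeodesicSpace X) {α : GeodesicSegment X} {k : ℕ}
    (hk : cdist K α.source α.target ≤ 2 ^ k) {m : X} (hm : m ∈ α.carrier) :
    ∃ c, cdist K α.source c ≤ cdist K α.source α.target ∧ cdist K m c ≤ k + 1 := by
  obtain ⟨f, h0, hn, hf⟩ := exists_chain_cdist (K := K) hX α.source α.target
  obtain ⟨l, -, hl, h⟩ := exists_cdist_chain_le hX hf k (Nat.zero_le _) (by omega) h0.symm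
    hn.symm hm
  have := cdist_le_of_chain hX hf (Nat.zero_le l)
  rw [h0] at this
  exact ⟨f l, by omega, h⟩

/-- Along a geodesic segment the coarse distance takes all values, up to an error of one. -/
theorem exists_cdist_eq (hX : IsGeodesicSpace X) (α : GeodesicSegment X) {u : ℕ}
    (hu : u ≤ cdist K α.source α.target) :
    ∃ t ∈ Icc 0 α.length, cdist K α.source (α.toFun t) ≤ u + 1 ∧
      u ≤ cdist K α.source (α.toFun t) + 1 := by
  have hφ : ∀ s ∈ Icc 0 α.length, ∀ t ∈ Icc 0 α.length, |s - t| ≤ 1 →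
      |(cdist K α.source (α.toFun s) : ℝ) - cdist K α.source (α.toFun t)| ≤ 1 := by
    intro s hs t ht hst
    have h1 : cdist K (α.toFun s) (α.toFun t) ≤ 1 :=
      Near.cdist_le_one (.inl (by rwa [α.dist_eq s hs t ht]))
    have h2 := cdist_triangle (K := K) hX α.source (α.toFun s) (α.toFun t)
    have h3 := cdist_triangle (K := K) hX α.source (α.toFun t) (α.toFun s)
    rw [cdist_comm (α.toFun t)] at h3
    have h4 : (cdist K α.source (α.toFun t) : ℝ) ≤ cdist K α.source (α.toFun s) + 1 := by
      exact_mod_cast h2.trans (by omega)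
    have h5 : (cdist K α.source (α.toFun s) : ℝ) ≤ cdist K α.source (α.toFun t) + 1 := by
      exact_mod_cast h3.trans (by omega)
    rw [abs_le]
    constructor <;> linarith
  obtain ⟨t, ht, h⟩ := exists_abs_sub_le_of_le_of_le
    (φ := fun t => (cdist K α.source (α.toFun t) : ℝ)) (u := u) α.length_nonneg hφ
    (by change (cdist K α.source α.source : ℝ) ≤ u; simp [cdist_self])
    (by change (u : ℝ) ≤ cdist K α.source α.target; exact_mod_cast hu)
  rw [abs_le] at h
  have h1 : (cdist K α.source (α.toFun t) : ℝ) ≤ u + 1 := by linarith [h.2]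
  have h2 : (u : ℝ) ≤ cdist K α.source (α.toFun t) + 1 := by linarith [h.1]
  exact ⟨t, ht, by exact_mod_cast h1, by exact_mod_cast h2⟩

/-- The value 10 is the least possible; it produces the constant 9 below. -/
theorem six_mul_add_four_le_two_pow {D : ℕ} (hD : 10 ≤ D) : 6 * D + 4 ≤ 2 ^ (D - 4) := by
  induction D, hD using Nat.le_induction with
  | base => norm_num
  | succ n hn ih =>
    rw [show n + 1 - 4 = (n - 4) + 1 by omega, pow_succ]
    omega

/-- The usual proof of stability of geodesics. Let D be the optimal bound and let m be a point that
attains it. Leaving the segment at distance about 2D on both sides of m and joining the chain gives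
a detour whose portion of the chain has length at most 6D + 4. By the logarithmic bound m is then
within D - 1 of the chain once D is at least 10. -/
theorem exists_cdist_geodesic_le (hX : IsGeodesicSpace X) {α : GeodesicSegment X} {f : ℕ → X}
    (hf : ∀ i, Near K (f i) (f (i + 1))) (h0 : f 0 = α.source)
    (hn : f (cdist K α.source α.target) = α.target) {m : X} (hm : m ∈ α.carrier) :
    ∃ i ≤ cdist K α.source α.target, cdist K m (f i) ≤ 9 := by
  classical
  set n := cdist K α.source α.target with hndef
  have hex : ∃ D, ∀ m ∈ α.carrier, ∃ i ≤ n, cdist K m (f i) ≤ D := by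
    refine ⟨n + 1, fun m hm => ?_⟩
    obtain ⟨l, -, hl, h⟩ := exists_cdist_chain_le hX hf n (Nat.zero_le n)
      (by rw [zero_add]; exact Nat.lt_two_pow_self.le) h0.symm hn.symm hm
    exact ⟨l, hl, h⟩
  suffices hD : Nat.find hex ≤ 9 by
    obtain ⟨i, hi, h⟩ := Nat.find_spec hex m hm
    exact ⟨i, hi, h.trans hD⟩
  by_contra hD
  push Not at hD
  have hspec := Nat.find_spec hex
  have hmin := Nat.find_min hex (Nat.sub_lt (by omega : 0 < Nat.find hex) one_pos)
  generalize Nat.find hex = D at hD hspec hmin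
  push Not at hmin
  obtain ⟨m, ⟨t, ht, rfl⟩, hfar⟩ := hmin
  -- points of the segment on both sides at distance about `2 * D`, or the endpoints
  have side : ∀ σ : GeodesicSegment X, ∃ s ∈ Icc 0 σ.length, cdist K σ.source (σ.toFun s) ≤ 2 * D + 2 ∧
      (2 * D ≤ cdist K σ.source (σ.toFun s) ∨ s = σ.length) := by
    intro σ
    rcases le_total (2 * D + 1) (cdist K σ.source σ.target) with h | h
    · obtain ⟨s, hs, h1, h2⟩ := exists_cdist_eq hX σ h
      exact ⟨s, hs, by omega, .inl (by omega)⟩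
    · refine ⟨σ.length, σ.length_mem, ?_, .inr rfl⟩
      change cdist K σ.source σ.target ≤ _
      omega
  have htri := cdist_triangle (K := K) hX
  -- the connection from a side point to the chain
  have conn : ∀ p ∈ α.carrier, cdist K (α.toFun t) p ≤ 2 * D + 2 →
      (2 * D ≤ cdist K (α.toFun t) p ∨ ∃ i ≤ n, f i = p) →
      ∃ i ≤ n, cdist K (α.toFun t) (f i) ≤ 3 * D + 2 ∧
        ∀ σ : GeodesicSegment X, σ.source = p → σ.target = f i → ∀ c ∈ σ.carrier,
          D ≤ cdist K (α.toFun t) c + (D - 4) + 1 := by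
    rintro p hp h1 (h2 | ⟨i, hi, rfl⟩)
    · obtain ⟨i, hi, h⟩ := hspec p hp
      refine ⟨i, hi, ?_, fun σ hσ1 hσ2 c hc => ?_⟩
      · have := htri (α.toFun t) p (f i)
        omega
      -- The connecting segment starts at coarse distance at least 2D from m and has coarse length
      -- at most D, so its points are at least three moves from m.
      · have := six_mul_add_four_le_two_pow hD
        obtain ⟨e, he1, he2⟩ := exists_cdist_le_of_segment (K := K) hX (α := σ) (k := D - 4)
          (by rw [hσ1, hσ2]; omega) hc
        rw [hσ1, hσ2] at he1
        have k1 := htri (α.toFun t) e p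
        have k2 := htri (α.toFun t) c e
        rw [cdist_comm e p] at k1
        omega
    · refine ⟨i, hi, by omega, fun σ hσ1 hσ2 c hc => ?_⟩
      have : c = f i := by
        have e1 := σ.dist_add_dist hc
        rw [hσ1, hσ2, dist_self] at e1
        exact dist_le_zero.1 (by linarith [dist_nonneg (x := f i) (y := c), dist_comm c (f i)])
      have := hfar i hi
      subst_vars
      omega
  obtain ⟨s₁, hs₁, a1, a2⟩ := side (α.sub 0 t le_rfl ht.1 ht.2).rev
  obtain ⟨s₂, hs₂, b1, b2⟩ := side (α.sub t α.length ht.1 ht.2 le_rfl)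
  simp only [GeodesicSegment.rev_source, GeodesicSegment.sub_target,
    GeodesicSegment.sub_source] at a1 a2 b1 b2
  simp only [GeodesicSegment.rev, GeodesicSegment.sub, sub_zero, zero_add] at hs₁ hs₂ a1 a2 b1 b2
  obtain ⟨i, hi, c1, c2⟩ := conn _ (α.apply_mem (t := t - s₁) (by linarith [hs₁.2])
    (by linarith [hs₁.1, ht.2])) a1
    (a2.imp_right fun h => ⟨0, Nat.zero_le _, by rw [h, h0]; simp [GeodesicSegment.source]⟩)
  obtain ⟨j, hj, d1, d2⟩ := conn _ (α.apply_mem (t := t + s₂) (by linarith [hs₂.1, ht.1])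
    (by linarith [hs₂.2])) b1
    (b2.imp_right fun h => ⟨n, le_rfl, by rw [h, hn]; simp [GeodesicSegment.target]⟩)
  -- two triangles fill the quadrangle
  set τ := α.sub (t - s₁) (t + s₂) (by linarith [hs₁.2]) (by linarith [hs₁.1, hs₂.1])
    (by linarith [hs₂.2]) with hτ
  have hτm : α.toFun t ∈ τ.carrier :=
    α.mem_sub_carrier _ _ _ (by linarith [hs₁.1]) (by linarith [hs₂.1])
  have τ1 : τ.source = α.toFun (t - s₁) := by simp [hτ]
  have τ2 : τ.target = α.toFun (t + s₂) := by simp [hτ]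
  obtain ⟨β, hβ1, hβ2⟩ := hX (f i) (α.toFun (t - s₁))
  obtain ⟨ε, hε1, hε2⟩ := hX (α.toFun (t + s₂)) (f i)
  obtain ⟨ζ, hζ1, hζ2⟩ := hX (f i) (f j)
  obtain ⟨η, hη1, hη2⟩ := hX (f j) (α.toFun (t + s₂))
  have := six_mul_add_four_le_two_pow hD
  obtain ⟨c, hc, hmc⟩ := exists_near_of_triangle (K := K) (α := τ) (β := ε) (δ := β)
    (by rw [τ2, hε1]) (by rw [hε2, hβ1]) (by rw [τ1, hβ2]) hτm
  have e1 := hmc.cdist_le_one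
  rcases hc with hc | hc
  · obtain ⟨c', hc', hmc'⟩ := exists_near_of_triangle (K := K) (α := ε) (β := ζ) (δ := η)
      (by rw [hε2, hζ1]) (by rw [hζ2, hη1]) (by rw [hε1, hη2]) hc
    have e2 := hmc'.cdist_le_one
    have e3 := htri (α.toFun t) c c'
    rcases hc' with hc' | hc'
    · have e4 := htri (f i) (α.toFun t) (f j)
      rw [cdist_comm (f i) (α.toFun t)] at e4
      have main : ∃ l ≤ n, cdist K c' (f l) ≤ (D - 4) + 1 := by
        -- The chain is shortest, so coarse distances between its points bound differences of
        -- indices.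
        have hchain : ∀ i j : ℕ, i ≤ n → j ≤ n → i ≤ j → j - i ≤ cdist K (f i) (f j) := by
          intro i j hi hj hij
          have g1 := cdist_le_of_chain hX hf (Nat.zero_le i)
          have g2 := cdist_le_of_chain hX hf hj
          have g3 := htri (f 0) (f i) (f n)
          have g4 := htri (f i) (f j) (f n)
          rw [h0, hn] at g3
          rw [h0] at g1
          rw [hn] at g4 g2
          omega
        rcases le_total i j with hij | hij
        · have := hchain i j hi hj hij
          obtain ⟨l, hl1, hl2, hl3⟩ := exists_cdist_chain_le hX hf (D - 4) hij (by omega)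
            hζ1 hζ2 hc'
          exact ⟨l, by omega, hl3⟩
        · have := hchain j i hj hi hij
          rw [cdist_comm] at this
          obtain ⟨l, hl1, hl2, hl3⟩ := exists_cdist_chain_le hX hf (D - 4) (α := ζ.rev) hij
            (by omega) (by simp [hζ2]) (by simp [hζ1]) (by simpa using hc')
          exact ⟨l, by omega, hl3⟩
      obtain ⟨l, hl, h⟩ := main
      have := hfar l hl
      have := htri (α.toFun t) c' (f l)
      omega
    · have := d2 η.rev (by simp [hη2]) (by simp [hη1]) c' (by simpa)
      omega
  · have := c2 β.rev (by simp [hβ2]) (by simp [hβ1]) c (by simpa)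
    omega

/-- A shortest chain is exactly additive and passes within 9 of m; hence the error 18. -/
theorem cdist_add_cdist_le (hX : IsGeodesicSpace X) {α : GeodesicSegment X} {m : X}
    (hm : m ∈ α.carrier) :
    cdist K α.source m + cdist K m α.target ≤ cdist K α.source α.target + 18 := by
  obtain ⟨f, h0, hn, hf⟩ := exists_chain_cdist (K := K) hX α.source α.target
  obtain ⟨i, hi, h⟩ := exists_cdist_geodesic_le hX hf h0 hn hm
  have g1 := cdist_le_of_chain hX hf (Nat.zero_le i)
  have g2 := cdist_le_of_chain hX hf hi
  rw [h0] at g1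
  rw [hn] at g2
  have g3 := cdist_triangle (K := K) hX α.source (f i) m
  have g4 := cdist_triangle (K := K) hX m (f i) α.target
  rw [cdist_comm (f i) m] at g3
  omega

/-- The centre is the first integer time at which α is near the side β. One unit earlier α was near
the other side δ, so the centre lies within two moves of both; hence 22 = 18 + 2 · 2. -/
theorem exists_center (hX : IsGeodesicSpace X) (α : GeodesicSegment X) (c : X) :
    ∃ t ∈ Icc 0 α.length,
      cdist K α.source (α.toFun t) + cdist K (α.toFun t) c ≤ cdist K α.source c + 22 ∧
      cdist K α.target (α.toFun t) + cdist K (α.toFun t) c ≤ cdist K α.target c + 22 := by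
  classical
  obtain ⟨β, hβ1, hβ2⟩ := hX α.target c
  obtain ⟨δ, hδ1, hδ2⟩ := hX c α.source
  have htri := cdist_triangle (K := K) hX
  have hmem : ∀ k : ℕ, min (k : ℝ) α.length ∈ Icc 0 α.length := fun k =>
    ⟨le_min k.cast_nonneg α.length_nonneg, min_le_right _ _⟩
  have hex : ∃ k : ℕ, ∃ v ∈ β.carrier, Near K (α.toFun (min k α.length)) v := by
    obtain ⟨k, hk⟩ := exists_nat_ge α.length
    refine ⟨k, β.source, β.source_mem, ?_⟩
    rw [min_eq_right hk, hβ1]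
    exact .refl _
  obtain ⟨v, hv, hv'⟩ := Nat.find_spec hex
  have hu : ∃ u ∈ δ.carrier, cdist K (α.toFun (min (Nat.find hex : ℝ) α.length)) u ≤ 2 := by
    rcases Nat.eq_zero_or_pos (Nat.find hex) with h | h
    · refine ⟨δ.target, δ.target_mem, ?_⟩
      rw [h, hδ2]
      simp [α.length_nonneg, GeodesicSegment.source, cdist_self]
    · have h3 := Nat.find_min hex (Nat.sub_lt h one_pos)
      obtain ⟨u, hu, hu'⟩ := exists_near_of_triangle (K := K) (α := α) (β := β) (δ := δ)
        hβ1.symm (by rw [hβ2, hδ1]) hδ2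
        (α.apply_mem (hmem (Nat.find hex - 1)).1 (hmem (Nat.find hex - 1)).2)
      rcases hu with hu | hu
      · exact absurd ⟨u, hu, hu'⟩ h3
      · refine ⟨u, hu, ?_⟩
        have h4 := (near_chain_of_segment (K := K) α (Nat.find hex - 1)).symm.cdist_le_one
        rw [Nat.sub_add_cancel h] at h4
        have := hu'.cdist_le_one
        have := htri _ _ _ |>.trans (add_le_add h4 this)
        exact this
  refine ⟨_, hmem (Nat.find hex), ?_⟩
  obtain ⟨u, hu, hu'⟩ := hu
  have hv2 := hv'.cdist_le_one
  generalize α.toFun (min (Nat.find hex : ℝ) α.length) = m at *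
  have g1 := cdist_add_cdist_le (K := K) hX hv
  have g2 := cdist_add_cdist_le (K := K) hX hu
  rw [hβ1, hβ2] at g1
  rw [hδ1, hδ2] at g2
  have e1 := htri α.source u m
  have e2 := htri m u c
  have e3 := htri α.target v m
  have e4 := htri m v c
  rw [cdist_comm u m] at e1
  rw [cdist_comm v m] at e3
  rw [cdist_comm c u, cdist_comm u α.source, cdist_comm c] at g2
  constructor <;> omega

/-- The four-point inequality for the coarse distance. -/
theorem cdist_four_point (hX : IsGeodesicSpace X) (a b c d : X) :
    cdist K a b + cdist K c d ≤
      max (cdist K a c + cdist K b d) (cdist K a d + cdist K b c) + 80 := by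
  obtain ⟨α, rfl, rfl⟩ := hX a b
  obtain ⟨s, hs, s1, s2⟩ := exists_center (K := K) hX α c
  obtain ⟨t, ht, t1, t2⟩ := exists_center (K := K) hX α d
  have htri := cdist_triangle (K := K) hX
  have k1 := htri α.source (α.toFun s) α.target
  have k2 := htri α.source (α.toFun t) α.target
  have k3 := htri c (α.toFun s) d
  have k4 := htri (α.toFun s) (α.toFun t) d
  have k5 := htri (α.toFun s) (α.toFun t) α.target
  have k6 := htri (α.toFun t) (α.toFun s) α.target
  have c1 := cdist_comm (K := K) α.target (α.toFun s)
  have c2 := cdist_comm (K := K) α.target (α.toFun t)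
  have c3 := cdist_comm (K := K) α.target c
  have c4 := cdist_comm (K := K) α.target d
  have c5 := cdist_comm (K := K) c (α.toFun s)
  have c6 := cdist_comm (K := K) (α.toFun t) (α.toFun s)
  -- The order of the two centres on α selects the pairing that dominates. The error is 80 = 2 · 22
  -- + 2 · 18.
  rcases le_total s t with hst | hst
  · have g1 := cdist_add_cdist_le (K := K) hX (α := α.sub 0 t le_rfl ht.1 ht.2)
      (α.mem_sub_carrier _ _ _ hs.1 hst)
    have g2 := cdist_add_cdist_le (K := K) hX (α := α.sub s α.length hs.1 hs.2 le_rfl)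
      (α.mem_sub_carrier _ _ _ hst ht.2)
    simp only [GeodesicSegment.sub_source, GeodesicSegment.sub_target] at g1 g2
    change cdist K α.source _ + _ ≤ cdist K α.source _ + _ at g1
    change _ + cdist K _ α.target ≤ cdist K _ α.target + _ at g2
    omega
  · have g1 := cdist_add_cdist_le (K := K) hX (α := α.sub 0 s le_rfl hs.1 hs.2)
      (α.mem_sub_carrier _ _ _ ht.1 hst)
    have g2 := cdist_add_cdist_le (K := K) hX (α := α.sub t α.length ht.1 ht.2 le_rfl)
      (α.mem_sub_carrier _ _ _ hst hs.2)
    simp only [GeodesicSegment.sub_source, GeodesicSegment.sub_target] at g1 g2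
    change cdist K α.source _ + _ ≤ cdist K α.source _ + _ at g1
    change _ + cdist K _ α.target ≤ cdist K _ α.target + _ at g2
    omega

/-! ### Coarse lines and their contraction -/

/-- Supplies the hypothesis of the bottleneck lemma: when x, o₁, o₂, z are coarsely aligned with o₁
and o₂ far apart, a point of [x, o₁] is never near a point of [o₂, z]. -/
theorem two_le_cdist_of_products (hX : IsGeodesicSpace X) {x o₁ o₂ z c c' : X} {F : ℕ}
    (h1 : cdist K x o₁ + cdist K o₁ o₂ ≤ cdist K x o₂ + F)
    (h2 : cdist K o₁ o₂ + cdist K o₂ z ≤ cdist K o₁ z + F)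
    (hc : cdist K x c + cdist K c o₁ ≤ cdist K x o₁ + 18)
    (hc' : cdist K o₂ c' + cdist K c' z ≤ cdist K o₂ z + 18)
    (hF : 2 * F + 400 ≤ cdist K o₁ o₂) : 2 ≤ cdist K c c' := by
  have f1 := cdist_four_point (K := K) hX x o₂ c o₁
  have f2 := cdist_four_point (K := K) hX o₁ z o₂ c'
  have f3 := cdist_four_point (K := K) hX c o₂ o₁ c'
  have t1 := cdist_triangle (K := K) hX o₁ c o₂
  have t2 := cdist_triangle (K := K) hX o₁ c' o₂
  have c1 := cdist_comm (K := K) c o₁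
  have c2 := cdist_comm (K := K) c o₂
  have c3 := cdist_comm (K := K) c' o₁
  have c4 := cdist_comm (K := K) c' o₂
  have c5 := cdist_comm (K := K) o₂ o₁
  have c6 := cdist_comm (K := K) z c'
  have c7 := cdist_comm (K := K) z o₂
  have g1 : cdist K o₁ o₂ + cdist K c o₁ ≤ cdist K c o₂ + F + 98 := by
    rcases le_max_iff.1 (Nat.sub_le_iff_le_add.2 f1) with f | f <;> omega
  have g2 : cdist K o₁ o₂ + cdist K o₂ c' ≤ cdist K o₁ c' + F + 98 := by
    rcases le_max_iff.1 (Nat.sub_le_iff_le_add.2 f2) with f | f <;> omega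
  rcases le_max_iff.1 (Nat.sub_le_iff_le_add.2 f3) with f | f <;> omega

/-- A bi-infinite sequence of points along which the coarse distance is coarsely additive. -/
structure IsCoarseLine (K : ContractionGauge) (y : ℤ → X) (M : ℝ) (E : ℕ) : Prop where
  dist_le : ∀ i, dist (y i) (y (i + 1)) ≤ M
  add_le : ∀ i j k, i ≤ j → j ≤ k →
    cdist K (y i) (y j) + cdist K (y j) (y k) ≤ cdist K (y i) (y k) + E
  le_cdist : ∀ i j, i ≤ j → j - i ≤ (cdist K (y i) (y j) : ℤ)

/-- `y u` is a point of `y '' I` at minimal coarse distance from `x`. -/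
def IsCoarseProj (K : ContractionGauge) (y : ℤ → X) (I : Set ℤ) (x : X) (u : ℤ) : Prop :=
  u ∈ I ∧ ∀ j ∈ I, cdist K x (y u) ≤ cdist K x (y j)

theorem exists_isCoarseProj (y : ℤ → X) {I : Set ℤ} (hI : I.Nonempty) (x : X) :
    ∃ u, IsCoarseProj K y I x u := by
  obtain ⟨u, hu, h⟩ := exists_minimalFor_of_wellFoundedLT (· ∈ I) (fun j => cdist K x (y j)) hI
  exact ⟨u, hu, fun j hj => (le_total _ _).elim id (fun h' => h hj h')⟩

theorem isCoarseProj_self (y : ℤ → X) {I : Set ℤ} {j : ℤ} (hj : j ∈ I) :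
    IsCoarseProj K y I (y j) j := ⟨hj, by simp [cdist_self]⟩

namespace IsCoarseLine

variable {y : ℤ → X} {M : ℝ} {E : ℕ}

theorem nonneg (hy : IsCoarseLine K y M E) : 0 ≤ M := dist_nonneg.trans (hy.dist_le 0)

theorem dist_le_mul (hy : IsCoarseLine K y M E) (i j : ℤ) :
    dist (y i) (y j) ≤ M * |(i : ℝ) - j| := by
  wlog h : i ≤ j generalizing i j
  · rw [dist_comm, abs_sub_comm]; exact this j i (le_of_not_ge h)
  induction j, h using Int.leInduction with
  | base => simp
  | succ j hij ih =>
    have e : (i : ℝ) ≤ j := by exact_mod_cast hij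
    rw [abs_sub_comm, abs_of_nonneg (by linarith)] at ih
    rw [abs_sub_comm, abs_of_nonneg (by push_cast; linarith)]
    push_cast
    linarith [dist_triangle (y i) (y j) (y (j + 1)), hy.dist_le j]

theorem cdist_le_mul (hX : IsGeodesicSpace X) (hy : IsCoarseLine K y M E) (i : ℤ) (n : ℕ) :
    cdist K (y i) (y (i + n)) ≤ n * (⌈M⌉₊ + 1) := by
  induction n with
  | zero => simp [cdist_self]
  | succ n ih =>
    have h1 := cdist_triangle (K := K) hX (y i) (y (i + n)) (y (i + (n + 1 : ℕ)))
    have h2 := hy.dist_le (i + n)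
    have h3 := cdist_le_dist_add_one (K := K) hX (y (i + n)) (y (i + n + 1))
    have h4 : (cdist K (y (i + n)) (y (i + n + 1)) : ℝ) ≤ (⌈M⌉₊ + 1 : ℕ) := by
      push_cast; linarith [Nat.le_ceil M]
    have h5 : cdist K (y (i + n)) (y (i + n + 1)) ≤ ⌈M⌉₊ + 1 := by exact_mod_cast h4
    rw [show i + ((n + 1 : ℕ) : ℤ) = i + n + 1 by push_cast; ring] at h1 ⊢
    rw [add_mul, one_mul]
    omega

theorem abs_sub_le_cdist (hy : IsCoarseLine K y M E) (i j : ℤ) :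
    |(i : ℝ) - j| ≤ cdist K (y i) (y j) := by
  rcases le_total i j with h | h
  · have := hy.le_cdist i j h
    have h2 : ((j - i : ℤ) : ℝ) ≤ (cdist K (y i) (y j) : ℤ) := by exact_mod_cast this
    have h3 : (i : ℝ) ≤ j := by exact_mod_cast h
    rw [abs_sub_comm, abs_of_nonneg (by linarith)]
    simpa using h2
  · have := hy.le_cdist j i h
    rw [cdist_comm] at this
    have h2 : ((i - j : ℤ) : ℝ) ≤ (cdist K (y i) (y j) : ℤ) := by exact_mod_cast this
    have h3 : (j : ℝ) ≤ i := by exact_mod_cast h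
    rw [abs_of_nonneg (by linarith)]
    simpa using h2

theorem abs_sub_le_dist (hX : IsGeodesicSpace X) (hy : IsCoarseLine K y M E) (i j : ℤ) :
    |(i : ℝ) - j| ≤ dist (y i) (y j) + 1 :=
  (hy.abs_sub_le_cdist i j).trans (cdist_le_dist_add_one hX _ _)

/-- The constant in `cdist_add_le`. -/
noncomputable def projConst (M : ℝ) (E : ℕ) : ℕ := (E + 81) * (⌈M⌉₊ + 1) + 80

/-- The coarse form of the statement that a path from x to the line may pass through the projection
of x. Up to E + 81 indices away from u, the bounded steps suffice; farther away, the four-point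
inequality is applied with the point E + 81 indices from u. -/
theorem cdist_add_le (hX : IsGeodesicSpace X) (hy : IsCoarseLine K y M E) {I : Set ℤ}
    (hI : I.OrdConnected) {x : X} {u j : ℤ} (hu : IsCoarseProj K y I x u) (hj : j ∈ I) :
    cdist K x (y u) + cdist K (y u) (y j) ≤ cdist K x (y j) + projConst M E := by
  have hstep : ∀ (i : ℤ) (n : ℕ), n ≤ E + 81 →
      cdist K (y i) (y (i + n)) ≤ (E + 81) * (⌈M⌉₊ + 1) := fun i n hn =>
    (hy.cdist_le_mul hX i n).trans (Nat.mul_le_mul_right _ hn)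
  have hmin := hu.2 j hj
  unfold projConst
  generalize (E + 81) * (⌈M⌉₊ + 1) = A at *
  rcases le_total u j with h | h
  · rcases le_or_gt j (u + (E + 81 : ℕ)) with h' | h'
    · obtain ⟨n, rfl⟩ := Int.le.dest h
      have := hstep u n (by omega)
      omega
    · have hi : u + (E + 81 : ℕ) ∈ I := hI.out hu.1 hj ⟨by omega, h'.le⟩
      have g1 := hstep u (E + 81) le_rfl
      have g2 := hu.2 _ hi
      have g3 := cdist_four_point (K := K) hX x (y (u + (E + 81 : ℕ))) (y u) (y j)
      have g4 := hy.add_le u (u + (E + 81 : ℕ)) j (by omega) h'.le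
      have g5 := hy.le_cdist u (u + (E + 81 : ℕ)) (by omega)
      rw [cdist_comm (y (u + (E + 81 : ℕ))) (y u)] at g3
      -- The gap E + 81 exceeds the total error E + 80 of additivity and of the four-point
      -- inequality, which excludes the first alternative.
      rcases le_max_iff.1 (Nat.sub_le_iff_le_add.2 g3) with f | f <;> omega
  · rcases le_or_gt u (j + (E + 81 : ℕ)) with h' | h'
    · obtain ⟨n, rfl⟩ := Int.le.dest h
      have := hstep j n (by omega)
      rw [cdist_comm] at this
      omega
    · have hi : u - (E + 81 : ℕ) ∈ I := hI.out hj hu.1 ⟨by omega, by omega⟩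
      have g1 := hstep (u - (E + 81 : ℕ)) (E + 81) le_rfl
      rw [sub_add_cancel] at g1
      have g2 := hu.2 _ hi
      have g3 := cdist_four_point (K := K) hX x (y (u - (E + 81 : ℕ))) (y u) (y j)
      have g4 := hy.add_le j (u - (E + 81 : ℕ)) u (by omega) (by omega)
      have g5 := hy.le_cdist (u - (E + 81 : ℕ)) u (by omega)
      rw [cdist_comm (y j), cdist_comm (y j) (y u)] at g4
      rcases le_max_iff.1 (Nat.sub_le_iff_le_add.2 g3) with f | f <;> omega

/-- The index gap in `exists_mem_carrier_dist_le`. -/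
noncomputable def gap (M : ℝ) (E : ℕ) : ℕ := 2 * (E + projConst M E) + 400

/-- The radius in `exists_mem_carrier_dist_le`. -/
noncomputable def radius (M : ℝ) (E : ℕ) : ℝ := 5 * (M * gap M E)

/-- The passage from coarse to metric information. The geodesics from the endpoints of σ to `y i`
and to the point `gap` indices later are nowhere near each other, so the bottleneck lemma forces σ
to pass close to `y i` in the metric of X. -/
theorem exists_mem_carrier_dist_le (hX : IsGeodesicSpace X) (hy : IsCoarseLine K y M E)
    {I : Set ℤ} (hI : I.OrdConnected) {u v i : ℤ} {σ : GeodesicSegment X}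
    (hu : IsCoarseProj K y I σ.source u) (hv : IsCoarseProj K y I σ.target v)
    (hui : u ≤ i) (hiv : i + gap M E ≤ v) : ∃ e ∈ σ.carrier, dist e (y i) ≤ radius M E := by
  obtain ⟨α, hα1, hα2⟩ := hX σ.source (y i)
  obtain ⟨β, hβ1, hβ2⟩ := hX (y (i + gap M E)) σ.target
  have hi : i ∈ I := hI.out hu.1 hv.1 ⟨hui, by omega⟩
  have hik : i + gap M E ∈ I := hI.out hu.1 hv.1 ⟨by omega, hiv⟩
  have p1 := hy.cdist_add_le hX hI hu hi
  have p2 := hy.cdist_add_le hX hI hu hik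
  have p3 := hy.cdist_add_le hX hI hv hi
  have p4 := hy.cdist_add_le hX hI hv hik
  have q1 := hy.add_le u i (i + gap M E) hui (by omega)
  have q2 := hy.add_le i (i + gap M E) v (by omega) hiv
  have l := hy.le_cdist i (i + gap M E) (by omega)
  have l' : gap M E ≤ cdist K (y i) (y (i + gap M E)) := by omega
  have t1 := cdist_triangle (K := K) hX σ.source (y u) (y i)
  have t2 := cdist_triangle (K := K) hX σ.target (y v) (y (i + gap M E))
  have c1 := cdist_comm (K := K) (y v) (y i)
  have c2 := cdist_comm (K := K) (y v) (y (i + gap M E))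
  have c3 := cdist_comm (K := K) σ.target (y i)
  have c4 := cdist_comm (K := K) σ.target (y (i + gap M E))
  obtain ⟨e, he, h⟩ := exists_dist_le_of_not_near (K := K) (α := α) (β := β) (σ := σ) hα1.symm
    hβ2.symm (fun c hc c' hc' hn => by
      have g1 := cdist_add_cdist_le (K := K) hX hc
      have g2 := cdist_add_cdist_le (K := K) hX hc'
      rw [hα1, hα2] at g1
      rw [hβ1, hβ2] at g2
      have := two_le_cdist_of_products (K := K) hX (F := E + projConst M E) (x := σ.source)
        (o₁ := y i) (o₂ := y (i + gap M E)) (z := σ.target) (by omega) (by omega) g1 g2 l'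
      have := hn.cdist_le_one
      omega)
  refine ⟨e, he, ?_⟩
  rw [hα2, hβ1] at h
  refine h.trans ?_
  have := hy.dist_le_mul i (i + gap M E)
  simp only [Int.cast_add, Int.cast_natCast, sub_add_cancel_left, abs_neg, Nat.abs_cast] at this
  unfold radius
  linarith

theorem dist_add_dist_le (hX : IsGeodesicSpace X) (hy : IsCoarseLine K y M E)
    {I : Set ℤ} (hI : I.OrdConnected) {u v i : ℤ} {x z : X}
    (hu : IsCoarseProj K y I x u) (hv : IsCoarseProj K y I z v)
    (hui : u ≤ i) (hiv : i + gap M E ≤ v) :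
    dist x (y i) + dist (y i) z ≤ dist x z + 2 * radius M E := by
  obtain ⟨σ, rfl, rfl⟩ := hX x z
  obtain ⟨e, he, h⟩ := hy.exists_mem_carrier_dist_le hX hI hu hv hui hiv
  have := σ.dist_add_dist he
  linarith [dist_triangle σ.source e (y i), dist_triangle (y i) e σ.target, dist_comm e (y i)]

/-- A geodesic from x to a point `y j` with j far from u passes close to `y u`, or to a point `gap`
indices from it. That point would be much closer to x than `y j`, whereas p is closest. -/
theorem abs_sub_le_of_mem_closestPoints (hX : IsGeodesicSpace X) (hy : IsCoarseLine K y M E)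
    {I : Set ℤ} (hI : I.OrdConnected) {Y : Set X} (hY : ∀ j ∈ I, ∃ p ∈ Y, dist (y j) p ≤ M)
    {x p : X} (hp : p ∈ closestPoints Y x) {u j : ℤ} (hj : j ∈ I) (hpj : dist p (y j) ≤ M)
    (hu : IsCoarseProj K y I x u) :
    |(j : ℝ) - u| ≤ gap M E + 2 * M + 2 * radius M E + 1 := by
  have hinf : ∀ i ∈ I, dist x p ≤ dist x (y i) + M := fun i hi => by
    obtain ⟨q, hq, h⟩ := hY i hi
    have h1 := infDist_le_dist_of_mem (x := x) hq
    rw [← hp.2] at h1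
    linarith [dist_triangle x (y i) q]
  have hM := hy.nonneg
  have hR : 0 ≤ radius M E := by unfold radius; positivity
  have hg : (0 : ℝ) ≤ gap M E := Nat.cast_nonneg _
  rcases le_or_gt (j + gap M E) u with h | h
  · have hi : u - gap M E ∈ I := hI.out hj hu.1 ⟨by omega, by omega⟩
    have h1 := hy.dist_add_dist_le hX hI (isCoarseProj_self y hj) hu (i := u - gap M E)
      (by omega) (by omega)
    have h2 := hinf _ hi
    have h3 := hy.abs_sub_le_dist hX j (u - gap M E)
    push_cast at h3
    have h4 : (j : ℝ) + gap M E ≤ u := by exact_mod_cast h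
    rw [abs_sub_comm, abs_of_nonneg (by linarith)] at h3 ⊢
    linarith [dist_triangle x p (y j), dist_comm x (y j), dist_comm x (y (u - gap M E))]
  rcases le_or_gt (u + gap M E) j with h' | h'
  · have h1 := hy.dist_add_dist_le hX hI hu (isCoarseProj_self y hj) le_rfl h'
    have h2 := hinf _ hu.1
    have h3 := hy.abs_sub_le_dist hX j u
    linarith [dist_triangle x p (y j), dist_comm (y j) (y u)]
  · have e1 : (u : ℝ) < j + gap M E := by exact_mod_cast h
    have e2 : (j : ℝ) < u + gap M E := by exact_mod_cast h'
    rw [abs_le]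
    constructor <;> linarith

/-- If the projections were far apart, [x, z] would pass close to a point `y i` with i close to u.
Since z is closer to x than Y is, z would then be close to `y i`, and so would its coarse
projection. -/
theorem abs_sub_le_of_dist_lt (hX : IsGeodesicSpace X) (hy : IsCoarseLine K y M E)
    {I : Set ℤ} (hI : I.OrdConnected) {Y : Set X} (hY : ∀ j ∈ I, ∃ p ∈ Y, dist (y j) p ≤ M)
    {x z : X} (hz : dist x z < infDist x Y) {u v : ℤ}
    (hu : IsCoarseProj K y I x u) (hv : IsCoarseProj K y I z v) :
    |(u : ℝ) - v| ≤ gap M E + 2 * (M + 2 * radius M E + 1) := by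
  have hinf : ∀ i ∈ I, dist x z ≤ dist x (y i) + M := fun i hi => by
    obtain ⟨q, hq, h⟩ := hY i hi
    linarith [dist_triangle x (y i) q, infDist_le_dist_of_mem (x := x) hq]
  have hM := hy.nonneg
  have hR : 0 ≤ radius M E := by unfold radius; positivity
  have hg : (0 : ℝ) ≤ gap M E := Nat.cast_nonneg _
  have key : ∀ i ∈ I, dist z (y i) ≤ M + 2 * radius M E →
      |(i : ℝ) - v| ≤ 2 * (M + 2 * radius M E + 1) := fun i hi h => by
    have h1 := hy.abs_sub_le_cdist i v
    have h2 : (cdist K (y i) (y v) : ℝ) ≤ cdist K z (y i) + cdist K z (y v) := by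
      have := cdist_triangle (K := K) hX (y i) z (y v)
      rw [cdist_comm (y i) z] at this
      exact_mod_cast this
    have h3 : (cdist K z (y v) : ℝ) ≤ cdist K z (y i) := by exact_mod_cast hv.2 i hi
    linarith [cdist_le_dist_add_one (K := K) hX z (y i)]
  rcases le_or_gt (u + gap M E) v with h | h
  · have h1 := hy.dist_add_dist_le hX hI hu hv le_rfl h
    have h2 := hinf _ hu.1
    linarith [key u hu.1 (by linarith [dist_comm z (y u)])]
  rcases le_or_gt (v + gap M E) u with h' | h'
  · have hi : u - gap M E ∈ I := hI.out hv.1 hu.1 ⟨by omega, by omega⟩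
    have h1 := hy.dist_add_dist_le hX hI hv hu (i := u - gap M E) (by omega) (by omega)
    have h2 := hinf _ hi
    have h3 := key _ hi (by linarith [dist_comm x z, dist_comm x (y (u - gap M E))])
    push_cast at h3
    rw [abs_le] at h3 ⊢
    constructor <;> linarith [h3.1, h3.2]
  · have e1 : (u : ℝ) < v + gap M E := by exact_mod_cast h'
    have e2 : (v : ℝ) < u + gap M E := by exact_mod_cast h
    rw [abs_le]
    constructor <;> linarith

/-- Metric projections stay close to coarse ones, and coarse projections hardly move on balls that
miss Y. The index set I covers axes and rays together. -/
theorem exists_isContracting (hX : IsGeodesicSpace X) (hy : IsCoarseLine K y M E)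
    {I : Set ℤ} (hI : I.OrdConnected) (hne : I.Nonempty) {Y : Set X}
    (hY : ∀ j ∈ I, ∃ p ∈ Y, dist (y j) p ≤ M) (hY' : ∀ p ∈ Y, ∃ j ∈ I, dist p (y j) ≤ M) :
    ∃ D : ℝ, 0 ≤ D ∧ IsContracting D Y := by
  have hM := hy.nonneg
  have hR : 0 ≤ radius M E := by unfold radius; positivity
  refine ⟨2 * M + M * (2 * (gap M E + 2 * M + 2 * radius M E + 1) +
    2 * (gap M E + 2 * (M + 2 * radius M E + 1))), by positivity, fun x => ediam_le ?_⟩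
  simp only [mem_iUnion, mem_ball, forall_exists_index]
  intro p z hz hp q z' hz' hq
  rw [edist_dist]
  refine ENNReal.ofReal_le_ofReal ?_
  obtain ⟨i, hi, hpi⟩ := hY' p hp.1
  obtain ⟨j, hj, hqj⟩ := hY' q hq.1
  obtain ⟨u, hu⟩ := exists_isCoarseProj (K := K) y hne x
  obtain ⟨v, hv⟩ := exists_isCoarseProj (K := K) y hne z
  obtain ⟨w, hw⟩ := exists_isCoarseProj (K := K) y hne z'
  rw [dist_comm] at hz hz'
  have a1 := hy.abs_sub_le_of_mem_closestPoints hX hI hY hp hi hpi hv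
  have a2 := hy.abs_sub_le_of_mem_closestPoints hX hI hY hq hj hqj hw
  have a3 := hy.abs_sub_le_of_dist_lt hX hI hY hz hu hv
  have a4 := hy.abs_sub_le_of_dist_lt hX hI hY hz' hu hw
  have a5 := hy.dist_le_mul i j
  have a6 : |(i : ℝ) - j| ≤ 2 * (gap M E + 2 * M + 2 * radius M E + 1) +
      2 * (gap M E + 2 * (M + 2 * radius M E + 1)) := by
    rw [abs_le] at *
    constructor <;> linarith [a1.1, a1.2, a2.1, a2.2, a3.1, a3.2, a4.1, a4.2]
  have a7 := mul_le_mul_of_nonneg_left a6 hM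
  linarith [dist_triangle4 p (y i) (y j) q, dist_comm q (y j)]

end IsCoarseLine

/-! ### The contraction space and the coarse distance -/

open PreContractionSpace

theorem Near.exists_chain {x y : X} (h : Near K x y) :
    ∃ L ≤ 1, Chain (pt x : PreContractionSpace X K) (pt y) L := by
  have key : ∀ {x y : X}, IsAntiContracting K x y →
      ∃ L ≤ 1, Chain (pt x : PreContractionSpace X K) (pt y) L := fun {x y} h => by
    let e : AntiContractingPair X K := ⟨(x, y), h⟩
    refine ⟨_, ?_, .cons (.enter_left e) (.cons (.interval e 0 1) (.cons (.leave_right e) (.nil _)))⟩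
    have : dist (0 : Icc (0 : ℝ) 1) 1 = 1 := by simp [Subtype.dist_eq]
    rw [this]; norm_num
  rcases h with h | h | h
  · exact ⟨_, h, (Step.space x y).chain⟩
  · exact key h
  · obtain ⟨L, hL, hc⟩ := key h
    exact ⟨L, hL, hc.symm⟩

theorem dist_pt_le_cdist (hX : IsGeodesicSpace X) (x y : X) :
    dist (pt x : PreContractionSpace X K) (pt y) ≤ cdist K x y := by
  obtain ⟨f, h0, hn, hf⟩ := exists_chain_cdist (K := K) hX x y
  have : ∀ n : ℕ, dist (pt (f 0) : PreContractionSpace X K) (pt (f n)) ≤ n := by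
    intro n
    induction n with
    | zero => simp
    | succ n ih =>
      obtain ⟨L, hL, hc⟩ := (hf n).exists_chain
      have h1 : dist (pt (f n) : PreContractionSpace X K) (pt (f (n + 1))) ≤ L := preDist_le hc
      push_cast
      linarith [dist_triangle (pt (f 0) : PreContractionSpace X K) (pt (f n)) (pt (f (n + 1)))]
  simpa [h0, hn] using this (cdist K x y)

/-- A lower bound for the length of chains that start at `pt x`. -/
def ChainBound (x : X) (L : ℝ) : PreContractionSpace X K → Prop
  | pt y => ∃ z, (cdist K x z : ℝ) / 2 + dist z y ≤ L
  | seg e t => (∃ z, (cdist K x z : ℝ) / 2 + dist z e.1.1 + t ≤ L) ∨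
      (∃ z, (cdist K x z : ℝ) / 2 + dist z e.1.2 + (1 - t) ≤ L)

/-- The factor 1/2 absorbs the unit lost in comparing `cdist` with the metric: a jump after moving a
distance s adds at most s + 2 to `cdist`, while the chain has paid s + 1. -/
theorem chainBound_jump (hX : IsGeodesicSpace X) {x z a b : X} {L : ℝ} (h : Near K a b)
    (hL : (cdist K x z : ℝ) / 2 + dist z a + 1 ≤ L) : (cdist K x b : ℝ) / 2 + dist b b ≤ L := by
  have h1 : (cdist K x b : ℝ) ≤ cdist K x z + (cdist K z a + cdist K a b) := by
    exact_mod_cast (cdist_triangle hX x z b).trans (by grw [cdist_triangle hX z a b])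
  have h2 : (cdist K a b : ℝ) ≤ 1 := by exact_mod_cast h.cdist_le_one
  have h3 := cdist_le_dist_add_one (K := K) hX z a
  rw [dist_self]
  linarith [dist_nonneg (x := z) (y := a)]

theorem Step.chainBound (hX : IsGeodesicSpace X) {x : X} {p q : PreContractionSpace X K}
    {c L : ℝ} (h : Step p q c) (hp : ChainBound x L p) : ChainBound x (L + c) q := by
  cases h with
  | space a b =>
    obtain ⟨z, hz⟩ := hp
    exact ⟨z, by linarith [dist_triangle z a b]⟩
  | interval e s t =>
    have hst : |(s : ℝ) - t| = dist s t := rfl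
    rw [← hst]
    rcases hp with ⟨z, hz⟩ | ⟨z, hz⟩
    · exact .inl ⟨z, by linarith [neg_abs_le ((s : ℝ) - t)]⟩
    · exact .inr ⟨z, by linarith [le_abs_self ((s : ℝ) - t)]⟩
  | enter_left e =>
    obtain ⟨z, hz⟩ := hp
    exact .inl ⟨z, by simpa using hz⟩
  | enter_right e =>
    obtain ⟨z, hz⟩ := hp
    exact .inr ⟨z, by simpa using hz⟩
  | leave_left e =>
    rcases hp with ⟨z, hz⟩ | ⟨z, hz⟩
    · exact ⟨z, by simpa using hz⟩
    -- The interval was entered at its other end and has been crossed completely.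
    · exact ⟨_, chainBound_jump hX (z := z) (.inr (.inr e.2)) (by simpa using hz)⟩
  | leave_right e =>
    rcases hp with ⟨z, hz⟩ | ⟨z, hz⟩
    · exact ⟨_, chainBound_jump hX (z := z) (.inr (.inl e.2)) (by simpa using hz)⟩
    · exact ⟨z, by simpa using hz⟩

theorem Chain.chainBound (hX : IsGeodesicSpace X) {x : X} {p q : PreContractionSpace X K}
    {c : ℝ} (h : Chain p q c) : ∀ {L : ℝ}, ChainBound x L p → ChainBound x (L + c) q := by
  induction h with
  | nil p => intro L h; simpa using h
  | cons hs _ ih => intro L h; rw [← add_assoc]; exact ih (hs.chainBound hX h)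

theorem cdist_le_dist_pt (hX : IsGeodesicSpace X) (x y : X) :
    (cdist K x y : ℝ) ≤ 2 * dist (pt x : PreContractionSpace X K) (pt y) + 1 := by
  have : ((cdist K x y : ℝ) - 1) / 2 ≤ dist (pt x : PreContractionSpace X K) (pt y) := by
    refine le_csInf (exists_chain _ _) fun L hL => ?_
    obtain ⟨z, hz⟩ := Chain.chainBound hX (x := x) hL
      (L := 0) ⟨x, by simp [cdist_self]⟩
    have h1 : (cdist K x y : ℝ) ≤ cdist K x z + cdist K z y := by
      exact_mod_cast cdist_triangle hX x z y
    linarith [cdist_le_dist_add_one (K := K) hX z y, dist_nonneg (x := z) (y := y)]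
  linarith

theorem exists_dist_pt_le_one (p : PreContractionSpace X K) : ∃ x : X, dist p (pt x) ≤ 1 := by
  cases p with
  | pt x => exact ⟨x, by simp⟩
  | seg e t =>
    refine ⟨e.1.1, (preDist_le
      ((Step.interval e t 0).chain.append (Step.leave_left e).chain)).trans ?_⟩
    have : dist t 0 = |(t : ℝ) - 0| := rfl
    rw [this, sub_zero, add_zero, abs_of_nonneg t.2.1]
    exact t.2.2

theorem ediam_contractionSpace_le (hX : IsGeodesicSpace X) {B : ℕ}
    (h : ∀ x y : X, cdist K x y ≤ B) :
    ediam (univ : Set (ContractionSpace X K)) ≤ ENNReal.ofReal (B + 2) := by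
  refine ediam_le fun p _ q _ => ?_
  rw [edist_dist]
  refine ENNReal.ofReal_le_ofReal ?_
  obtain ⟨p, rfl⟩ := SeparationQuotient.surjective_mk p
  obtain ⟨q, rfl⟩ := SeparationQuotient.surjective_mk q
  change dist p q ≤ _
  obtain ⟨x, hx⟩ := exists_dist_pt_le_one p
  obtain ⟨y, hy⟩ := exists_dist_pt_le_one q
  have h1 : (cdist K x y : ℝ) ≤ B := by exact_mod_cast h x y
  linarith [dist_triangle4 p (pt x) (pt y) q, dist_comm q (pt y),
    dist_pt_le_cdist (K := K) hX x y]

theorem isBounded_contractionSpace_iff (hX : IsGeodesicSpace X) :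
    Bornology.IsBounded (univ : Set (ContractionSpace X K)) ↔
      ∃ B : ℕ, ∀ x y : X, cdist K x y ≤ B := by
  constructor
  · intro h
    obtain ⟨C, hC⟩ := Metric.isBounded_iff.1 h
    obtain ⟨B, hB⟩ := exists_nat_ge (2 * C + 1)
    refine ⟨B, fun x y => ?_⟩
    have h1 : dist (pt x : PreContractionSpace X K) (pt y) ≤ C :=
      hC (x := (SeparationQuotient.mk (pt x) : SeparationQuotient (PreContractionSpace X K)))
        trivial (y := SeparationQuotient.mk (pt y)) trivial
    have h2 := cdist_le_dist_pt (K := K) hX x y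
    exact_mod_cast (show (cdist K x y : ℝ) ≤ B by linarith)
  · rintro ⟨B, hB⟩
    exact Metric.isBounded_iff_ediam_ne_top.2
      (ne_top_of_le_ne_top ENNReal.ofReal_ne_top (ediam_contractionSpace_le hX hB))

/-! ### Isometries -/

theorem GeodesicSegment.map_carrier {Y : Type*} [MetricSpace Y] (f : X → Y) (hf : Isometry f)
    (γ : GeodesicSegment X) : (γ.map f hf).carrier = f '' γ.carrier := by
  simp only [carrier, map, image_image]

theorem GeodesicSegment.IsThin.map {γ : GeodesicSegment X} {r : ℝ} (h : γ.IsThin r)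
    (g : X ≃ᵢ X) : (γ.map g g.isometry).IsThin r := by
  intro γ₁ γ₂ γ₃ γ₄ h1 h2 h3 h4 ⟨a, ha, hal, hat⟩
  obtain ⟨e, he, he'⟩ := h (γ₁.map g.symm g.symm.isometry) (γ₂.map g.symm g.symm.isometry)
    (γ₃.map g.symm g.symm.isometry) (γ₄.map g.symm g.symm.isometry)
    (congrArg g.symm h1) (congrArg g.symm h2) (congrArg g.symm h3) (congrArg g.symm h4)
    ⟨a, ha, hal, fun t ht => g.injective (by
      simpa [GeodesicSegment.map] using hat t ht)⟩
  refine ⟨g e, ?_, ?_⟩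
  · simp only [GeodesicSegment.map_carrier, ← image_union] at he
    obtain ⟨z, hz, rfl⟩ := he
    simpa using hz
  · rw [mem_closedBall] at he' ⊢
    exact (g.dist_eq e γ.midpoint).trans_le he'

theorem IsAntiContracting.map {x y : X} (h : IsAntiContracting K x y) (g : X ≃ᵢ X) :
    IsAntiContracting K (g x) (g y) := by
  refine ⟨by rw [g.dist_eq]; exact h.1, fun r γ γ' h1 h2 ⟨a, ha, hal, hat⟩ h4 h5 => ?_⟩
  refine h.2 r (γ.map g.symm g.symm.isometry) (γ'.map g.symm g.symm.isometry)
    ?_ ?_ ⟨a, ha, hal, fun t ht => congrArg g.symm (hat t ht)⟩ h4 (h5.map g.symm)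
  · exact (congrArg g.symm h1).trans (g.symm_apply_apply x)
  · exact (congrArg g.symm h2).trans (g.symm_apply_apply y)

theorem Near.map {x y : X} (h : Near K x y) (g : X ≃ᵢ X) : Near K (g x) (g y) := by
  rcases h with h | h | h
  · exact .inl (by rwa [g.dist_eq])
  · exact .inr (.inl (h.map g))
  · exact .inr (.inr (h.map g))

theorem cdist_map_le (hX : IsGeodesicSpace X) (g : X ≃ᵢ X) (x y : X) :
    cdist K (g x) (g y) ≤ cdist K x y := by
  obtain ⟨f, h0, hn, hf⟩ := exists_chain_cdist (K := K) hX x y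
  simpa [h0, hn] using
    cdist_le_of_chain hX (f := g ∘ f) (fun i => (hf i).map g) (Nat.zero_le (cdist K x y))

theorem cdist_map (hX : IsGeodesicSpace X) (g : X ≃ᵢ X) (x y : X) :
    cdist K (g x) (g y) = cdist K x y := by
  refine le_antisymm (cdist_map_le hX g x y) ?_
  simpa using cdist_map_le (K := K) hX g.symm (g x) (g y)

/-- The orbit of `o` is `P`-dense for the coarse distance. -/
def IsCoarselyDense (K : ContractionGauge) (o : X) (P : ℕ) : Prop :=
  ∀ y : X, ∃ g : X ≃ᵢ X, cdist K y (g o) ≤ P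

/-- One unit because the infimum defining the density need not be attained, one for the comparison
of `cdist` with the metric. -/
theorem exists_isCoarselyDense (hX : IsGeodesicSpace X) {ρ : ℝ≥0} (h : isomDensity X ≤ ρ) :
    ∃ o : X, IsCoarselyDense K o (⌈ρ⌉₊ + 2) := by
  have h1 : isomDensity X < (ρ + 1 : ℝ≥0) := h.trans_lt (by exact_mod_cast lt_add_one ρ)
  obtain ⟨o, ho⟩ := iInf_lt_iff.1 h1
  refine ⟨o, fun y => ?_⟩
  rw [hausdorffEDist_comm] at ho
  obtain ⟨_, ⟨g, rfl⟩, hg⟩ := exists_edist_lt_of_hausdorffEDist_lt (mem_univ y) ho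
  refine ⟨g, ?_⟩
  rw [edist_nndist] at hg
  have h2 : dist y (g o) < ρ + 1 := by exact_mod_cast hg
  have h3 := cdist_le_dist_add_one (K := K) hX y (g o)
  have h4 : (ρ : ℝ) ≤ ⌈ρ⌉₊ := by exact_mod_cast Nat.le_ceil ρ
  have h5 : (cdist K y (g o) : ℝ) ≤ (⌈ρ⌉₊ + 2 : ℕ) := by push_cast; linarith
  exact_mod_cast h5

/-- By the four-point inequality, the middle of a pair realising the diameter D is within D/2 + 100
of every point. An isometry moves one end of the pair within 2P of this centre, so D is at most 2P +
D/2 + 100. The extra unit is rounding. -/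
theorem cdist_le_of_bounded (hX : IsGeodesicSpace X) {o : X} {P : ℕ}
    (hP : IsCoarselyDense K o P) {B : ℕ} (hB : ∀ x y : X, cdist K x y ≤ B) (x y : X) :
    cdist K x y ≤ 4 * P + 201 := by
  classical
  have hex : ∃ B, ∀ x y : X, cdist K x y ≤ B := ⟨B, hB⟩
  suffices h : Nat.find hex ≤ 4 * P + 201 from (Nat.find_spec hex x y).trans h
  rcases Nat.eq_zero_or_pos (Nat.find hex) with h0 | h0
  · omega
  have hspec := Nat.find_spec hex
  have hmin := Nat.find_min hex (Nat.sub_lt h0 one_pos)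
  generalize Nat.find hex = D at *
  push Not at hmin
  obtain ⟨x, y, hxy⟩ := hmin
  obtain ⟨α, rfl, rfl⟩ := hX x y
  obtain ⟨t, ht, t1, t2⟩ := exists_cdist_eq (K := K) hX α (u := D / 2) (by omega)
  have hm := cdist_add_cdist_le (K := K) hX (α.apply_mem ht.1 ht.2)
  have hspec0 := hspec α.source α.target
  generalize α.toFun t = m at *
  have key : ∀ z, cdist K m z ≤ D / 2 + 100 := fun z => by
    have f := cdist_four_point (K := K) hX α.source α.target m z
    have h1 := hspec α.source z
    have h2 := hspec α.target z
    rw [cdist_comm α.target m] at f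
    rcases le_max_iff.1 (Nat.sub_le_iff_le_add.2 f) with f | f <;> omega
  obtain ⟨g, hg⟩ := hP m
  obtain ⟨h, hh⟩ := hP α.source
  have k1 := cdist_triangle (K := K) hX α.source (h o) α.target
  have k2 := cdist_map (K := K) hX (g * h⁻¹) (h o) α.target
  simp only [IsometryEquiv.mul_apply, IsometryEquiv.inv_apply_self] at k2
  have k3 := cdist_triangle (K := K) hX (g o) m (g (h⁻¹ α.target))
  have k4 := key (g (h⁻¹ α.target))
  rw [cdist_comm (g o) m] at k3
  omega

/-! ### Loxodromic isometries -/

/-- A local-to-global principle: displacement that grows enough from g to g² grows along all powers.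
-/
theorem isCoarseLine_of_add_le (hX : IsGeodesicSpace X) {g : X ≃ᵢ X} {o : X}
    (h : cdist K o (g o) + 161 ≤ cdist K o (g (g o))) :
    IsCoarseLine K (fun n : ℤ => (g ^ n) o) (dist o (g o))
      (2 * cdist K o (g o) + 160 - cdist K o (g (g o))) := by
  set b : ℕ → ℕ := fun n => cdist K o ((g ^ n) o) with hb
  have hshift : ∀ (i : ℕ) (n : ℕ), cdist K ((g ^ i) o) ((g ^ (i + n)) o) = b n := fun i n => by
    rw [pow_add, IsometryEquiv.mul_apply, cdist_map hX]
  have hzshift : ∀ (i : ℤ) (n : ℕ), cdist K ((g ^ i) o) ((g ^ (i + n)) o) = b n := fun i n => by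
    rw [zpow_add, IsometryEquiv.mul_apply, cdist_map hX, zpow_natCast]
  have hb0 : b 0 = 0 := by simp [hb, cdist_self]
  have hb1 : b 1 = cdist K o (g o) := by simp [hb]
  have hb2 : b 2 = cdist K o (g (g o)) := by simp [hb, pow_two]
  -- The induction hypothesis gives b (n + 1) ≥ b n + 81, which excludes the first alternative of
  -- the four-point inequality. This is where 161 = 2 · 80 + 1 is needed.
  have hstep : ∀ n, b n + b 2 ≤ b (n + 1) + b 1 + 80 := by
    intro n
    induction n with
    | zero => simp only [hb0, zero_add]
              have := cdist_triangle (K := K) hX o (g o) (g (g o))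
              rw [cdist_map hX] at this
              omega
    | succ n ih =>
      have f := cdist_four_point (K := K) hX o ((g ^ (n + 1)) o) ((g ^ n) o) ((g ^ (n + 2)) o)
      rw [hshift n 2, show n + 2 = (n + 1) + 1 from rfl, hshift (n + 1) 1,
        cdist_comm ((g ^ (n + 1)) o), hshift n 1] at f
      change b (n + 1) + b 2 ≤ max (b n + b 1) (b (n + 1 + 1) + b 1) + 80 at f
      rcases le_max_iff.1 (Nat.sub_le_iff_le_add.2 f) with f | f <;> omega
  have hadd : ∀ n k, b n + b k ≤ b (n + k) + (2 * b 1 + 160 - b 2) := by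
    intro n k
    rcases k with _ | k
    · simp only [hb0, add_zero]; omega
    · have f := cdist_four_point (K := K) hX o ((g ^ (n + 1)) o) ((g ^ n) o) ((g ^ (n + (k + 1))) o)
      rw [hshift n (k + 1), show n + (k + 1) = (n + 1) + k by ring, hshift (n + 1) k,
        cdist_comm ((g ^ (n + 1)) o), hshift n 1] at f
      change b (n + 1) + b (k + 1) ≤ max (b n + b k) (b (n + 1 + k) + b 1) + 80 at f
      have h1 := hstep n
      have h2 := hstep k
      have h3 : b 2 ≤ 2 * b 1 := by
        have := cdist_triangle (K := K) hX o (g o) (g (g o))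
        rw [cdist_map hX] at this
        omega
      rw [show n + (k + 1) = (n + 1) + k by ring]
      rcases le_max_iff.1 (Nat.sub_le_iff_le_add.2 f) with f | f <;> omega
  have hle : ∀ n, n ≤ b n := by
    intro n
    induction n with
    | zero => simp
    | succ n ih => have := hstep n; omega
  refine ⟨fun i => ?_, fun i j k hij hjk => ?_, fun i j hij => ?_⟩
  · rw [zpow_add, IsometryEquiv.mul_apply, IsometryEquiv.dist_eq, zpow_one]
  · obtain ⟨n, rfl⟩ := Int.le.dest hij
    obtain ⟨l, rfl⟩ := Int.le.dest hjk
    have e := hzshift i (n + l)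
    push_cast at e
    rw [hzshift, hzshift, add_assoc, e]
    have := hadd n l
    omega
  · obtain ⟨n, rfl⟩ := Int.le.dest hij
    rw [hzshift]
    have := hle n
    omega

/-- If o lies roughly between g o and h o, far from both, and neither g nor h satisfies the
inequality, then g⁻¹ o is on the side of g o and h⁻¹ o on the side of h o. The points (gh)⁻¹ o, h⁻¹
o, o, g o, gh o are then coarsely aligned, and gh satisfies it. -/
theorem exists_isometry_add_le (hX : IsGeodesicSpace X) {o : X} {P : ℕ}
    (hP : IsCoarselyDense K o P) (hB : ¬ ∃ B : ℕ, ∀ x y : X, cdist K x y ≤ B) :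
    ∃ g : X ≃ᵢ X, cdist K o (g o) + 161 ≤ cdist K o (g (g o)) := by
  by_contra hcon
  push Not at hcon hB
  -- The size 100P + 2000 dominates all errors below: replacing the endpoints and the middle by
  -- orbit points leaves a defect of 6P + 18, and each four-point inequality adds 80.
  obtain ⟨x, y, hxy⟩ := hB (2 * (100 * P + 2000))
  obtain ⟨α, rfl, rfl⟩ := hX x y
  obtain ⟨t, ht, t1, t2⟩ := exists_cdist_eq (K := K) hX α (u := 100 * P + 2000) (by omega)
  have hm := cdist_add_cdist_le (K := K) hX (α.apply_mem ht.1 ht.2)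
  have htri := cdist_triangle (K := K) hX
  have hm' := htri α.source (α.toFun t) α.target
  generalize α.toFun t = m at *
  obtain ⟨g₀, h0⟩ := hP m
  obtain ⟨g₁, h1⟩ := hP α.source
  obtain ⟨g₂, h2⟩ := hP α.target
  -- reduce to the orbit
  have e1 := htri α.source (g₁ o) m
  have e2 := htri (g₁ o) (g₀ o) m
  have e1' := htri (g₁ o) α.source (g₀ o)
  have e2' := htri α.source m (g₀ o)
  have e3 := htri m (g₀ o) α.target
  have e4 := htri (g₀ o) (g₂ o) α.target
  have e3' := htri (g₀ o) m (g₂ o)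
  have e4' := htri m α.target (g₂ o)
  have e5 := htri α.source (g₁ o) α.target
  have e6 := htri (g₁ o) (g₂ o) α.target
  have cc1 := cdist_comm (K := K) (g₁ o) α.source
  have cc2 := cdist_comm (K := K) (g₀ o) m
  have cc3 := cdist_comm (K := K) (g₂ o) α.target
  obtain ⟨g, hg⟩ : ∃ g, g = g₀⁻¹ * g₁ := ⟨_, rfl⟩
  obtain ⟨h, hh⟩ : ∃ h, h = g₀⁻¹ * g₂ := ⟨_, rfl⟩
  have a1 : cdist K o (g o) = cdist K (g₁ o) (g₀ o) := by
    rw [← cdist_map hX g₀, hg, ← IsometryEquiv.mul_apply, mul_inv_cancel_left, cdist_comm]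
  have a2 : cdist K o (h o) = cdist K (g₀ o) (g₂ o) := by
    rw [← cdist_map hX g₀, hh, ← IsometryEquiv.mul_apply, mul_inv_cancel_left]
  have a3 : cdist K (g o) (h o) = cdist K (g₁ o) (g₂ o) := by
    rw [← cdist_map hX g₀, hg, hh, ← IsometryEquiv.mul_apply, ← IsometryEquiv.mul_apply,
      mul_inv_cancel_left, mul_inv_cancel_left]
  have b1 := hcon g
  have b2 := hcon h
  have b3 := hcon (g * h)
  simp only [IsometryEquiv.mul_apply] at b3
  -- the distances between the points `h⁻¹ g⁻¹ o, h⁻¹ o, o, g o, g h o` and `g⁻¹ o, h o`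
  have d1 : cdist K o (g⁻¹ o) = cdist K o (g o) := by
    rw [← cdist_map hX g, IsometryEquiv.apply_inv_self, cdist_comm]
  have d2 : cdist K o (h⁻¹ o) = cdist K o (h o) := by
    rw [← cdist_map hX h, IsometryEquiv.apply_inv_self, cdist_comm]
  have d3 : cdist K (g o) (g⁻¹ o) = cdist K o (g (g o)) := by
    rw [← cdist_map hX g, IsometryEquiv.apply_inv_self, cdist_comm]
  have d4 : cdist K (h o) (h⁻¹ o) = cdist K o (h (h o)) := by
    rw [← cdist_map hX h, IsometryEquiv.apply_inv_self, cdist_comm]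
  have d5 : cdist K o (g (h o)) = cdist K (h o) (g⁻¹ o) := by
    rw [← cdist_map hX g (h o), IsometryEquiv.apply_inv_self, cdist_comm]
  have d6 : cdist K (h⁻¹ (g⁻¹ o)) (h⁻¹ o) = cdist K o (g o) := by
    rw [cdist_map hX, cdist_comm, d1]
  have d7 : cdist K (h⁻¹ (g⁻¹ o)) o = cdist K (h o) (g⁻¹ o) := by
    rw [← cdist_map hX h, IsometryEquiv.apply_inv_self, cdist_comm]
  have d8 : cdist K (g o) (g (h o)) = cdist K o (h o) := cdist_map hX g _ _
  have d9 : cdist K (h⁻¹ (g⁻¹ o)) (g (h o)) = cdist K o (g (h (g (h o)))) := by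
    rw [← cdist_map hX h, IsometryEquiv.apply_inv_self, ← cdist_map hX g,
      IsometryEquiv.apply_inv_self]
  have f1 := cdist_four_point (K := K) hX (g o) (h o) o (g⁻¹ o)
  have f2 := cdist_four_point (K := K) hX (g o) (h o) (h⁻¹ o) o
  have f3 := cdist_four_point (K := K) hX (h⁻¹ (g⁻¹ o)) o (h⁻¹ o) (g o)
  have f4 := cdist_four_point (K := K) hX (h⁻¹ (g⁻¹ o)) (g o) o (g (h o))
  have c1 := cdist_comm (K := K) (g o) o
  have c2 := cdist_comm (K := K) (h o) o
  have c3 := cdist_comm (K := K) (h⁻¹ o) o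
  have c4 := cdist_comm (K := K) (h⁻¹ o) (g o)
  have u1 := htri o (g o) (g (h o))
  have F1 : cdist K o (g o) + cdist K o (h o) ≤ cdist K (h o) (g⁻¹ o) + 6 * P + 98 := by
    rcases le_max_iff.1 (Nat.sub_le_iff_le_add.2 f1) with f | f <;> omega
  have F2 : cdist K o (g o) + cdist K o (h o) ≤ cdist K (g o) (h⁻¹ o) + 6 * P + 98 := by
    rcases le_max_iff.1 (Nat.sub_le_iff_le_add.2 f2) with f | f <;> omega
  have F3 : 2 * cdist K o (g o) + cdist K o (h o) ≤
      cdist K (h⁻¹ (g⁻¹ o)) (g o) + 2 * (6 * P + 98) + 80 := by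
    rcases le_max_iff.1 (Nat.sub_le_iff_le_add.2 f3) with f | f <;> omega
  rcases le_max_iff.1 (Nat.sub_le_iff_le_add.2 f4) with f | f <;> omega

/-! ### The axis of a loxodromic isometry -/

/-- The concatenation of the translates of the segment `σ` by the powers of `g`. -/
noncomputable def axis (g : X ≃ᵢ X) (σ : GeodesicSegment X) (t : ℝ) : X :=
  (g ^ ⌊t⌋) (σ.toFun (Int.fract t * σ.length))

section axis

variable {g : X ≃ᵢ X} {σ : GeodesicSegment X}

theorem fract_mul_mem (t : ℝ) : Int.fract t * σ.length ∈ Icc 0 σ.length :=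
  ⟨mul_nonneg (Int.fract_nonneg t) σ.length_nonneg,
    mul_le_of_le_one_left σ.length_nonneg (Int.fract_lt_one t).le⟩

theorem axis_intCast (n : ℤ) : axis g σ n = (g ^ n) σ.source := by
  simp [axis, GeodesicSegment.source]

theorem axis_add_one (t : ℝ) : axis g σ (t + 1) = g (axis g σ t) := by
  rw [axis, Int.floor_add_one, Int.fract_add_one, add_comm, zpow_add, zpow_one,
    IsometryEquiv.mul_apply, axis]

theorem dist_axis_floor (t : ℝ) :
    dist ((g ^ ⌊t⌋) σ.source) (axis g σ t) = Int.fract t * σ.length := by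
  rw [axis, IsometryEquiv.dist_eq, σ.dist_source (fract_mul_mem t).1 (fract_mul_mem t).2]

theorem dist_axis_floor_add_one (hσ : σ.target = g σ.source) (t : ℝ) :
    dist (axis g σ t) ((g ^ (⌊t⌋ + 1)) σ.source) = σ.length - Int.fract t * σ.length := by
  rw [axis, zpow_add, zpow_one, IsometryEquiv.mul_apply, IsometryEquiv.dist_eq, ← hσ,
    σ.dist_target (fract_mul_mem t).1 (fract_mul_mem t).2]

theorem dist_zpow_apply_le (hσ : σ.target = g σ.source) (i : ℤ) (n : ℕ) :
    dist ((g ^ i) σ.source) ((g ^ (i + n)) σ.source) ≤ σ.length * n := by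
  induction n with
  | zero => simp
  | succ n ih =>
    have h : dist ((g ^ (i + n)) σ.source) ((g ^ (i + n + 1)) σ.source) = σ.length := by
      rw [zpow_add _ _ 1, zpow_one, IsometryEquiv.mul_apply, IsometryEquiv.dist_eq, ← hσ,
        σ.dist_source_target]
    push_cast
    rw [← add_assoc]
    linarith [dist_triangle ((g ^ i) σ.source) ((g ^ (i + n)) σ.source)
      ((g ^ (i + n + 1)) σ.source)]

theorem dist_axis_le (hσ : σ.target = g σ.source) (s t : ℝ) :
    dist (axis g σ s) (axis g σ t) ≤ σ.length * |s - t| := by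
  wlog hst : s ≤ t generalizing s t
  · rw [dist_comm, abs_sub_comm]; exact this t s (le_of_not_ge hst)
  rw [abs_sub_comm, abs_of_nonneg (sub_nonneg.2 hst)]
  have es := Int.floor_add_fract s
  have et := Int.floor_add_fract t
  rcases (Int.floor_mono hst).eq_or_lt with h | h
  · rw [← h] at et
    rw [axis, axis, ← h, IsometryEquiv.dist_eq, σ.dist_eq _ (fract_mul_mem s) _ (fract_mul_mem t),
      ← sub_mul, abs_mul, abs_of_nonneg σ.length_nonneg, abs_sub_comm, abs_of_nonneg (by linarith),
      mul_comm]
    exact mul_le_mul_of_nonneg_left (by linarith) σ.length_nonneg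
  · obtain ⟨n, hn⟩ := Int.le.dest (show ⌊s⌋ + 1 ≤ ⌊t⌋ from h)
    have h1 := dist_zpow_apply_le hσ (⌊s⌋ + 1) n
    have h2 := dist_axis_floor_add_one hσ s
    have h3 := dist_axis_floor (g := g) (σ := σ) t
    rw [← hn] at h3
    have h4 : (⌊t⌋ : ℝ) = ⌊s⌋ + 1 + n := by rw [← hn]; push_cast; ring
    have h5 : t - s = (1 - Int.fract s) + n + Int.fract t := by linarith
    rw [h5]
    linarith [dist_triangle4 (axis g σ s) ((g ^ (⌊s⌋ + 1)) σ.source)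
      ((g ^ (⌊s⌋ + 1 + n)) σ.source) (axis g σ t)]

end axis

theorem isLoxodromic_of_isCoarseLine (hX : IsGeodesicSpace X) {g : X ≃ᵢ X} {o : X} {M : ℝ} {E : ℕ}
    (hy : IsCoarseLine K (fun n : ℤ => (g ^ n) o) M E) : IsLoxodromic g := by
  have hM := hy.nonneg
  refine ⟨o, M + 1, by linarith, fun m n => ⟨?_, ?_⟩⟩
  · have h1 := hy.abs_sub_le_dist hX m n
    have h2 := div_le_self (abs_nonneg ((m : ℝ) - n)) (show 1 ≤ M + 1 by linarith)
    linarith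
  · have h1 := hy.dist_le_mul m n
    linarith [abs_nonneg ((m : ℝ) - n)]

theorem isStronglyContractingElement_of_isCoarseLine (hX : IsGeodesicSpace X) {g : X ≃ᵢ X} {o : X}
    {E : ℕ} (hy : IsCoarseLine K (fun n : ℤ => (g ^ n) o) (dist o (g o)) E) :
    IsStronglyContractingElement g := by
  refine ⟨isLoxodromic_of_isCoarseLine hX hy, ?_⟩
  obtain ⟨σ, rfl, hσ⟩ := hX o (g o)
  have hlen : dist σ.source (g σ.source) = σ.length := by rw [← hσ, σ.dist_source_target]
  have hl := σ.length_nonneg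
  have hfl : ∀ t : ℝ, dist ((g ^ ⌊t⌋) σ.source) (axis g σ t) ≤ σ.length := fun t => by
    rw [dist_axis_floor]; exact (fract_mul_mem t).2
  obtain ⟨D, hD, hcon⟩ := hy.exists_isContracting hX (I := univ) ordConnected_univ univ_nonempty
    (Y := range (axis g σ))
    (fun j _ => ⟨_, ⟨j, rfl⟩, by rw [axis_intCast, dist_self]; positivity⟩)
    (by rintro _ ⟨t, rfl⟩; exact ⟨⌊t⌋, trivial, by rw [dist_comm, hlen]; exact hfl t⟩)
  refine ⟨D + 2 * σ.length + 3, axis g σ, ⟨by linarith, ?_, fun s t => ⟨?_, ?_⟩⟩, ?_, ?_⟩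
  · refine (LipschitzWith.of_dist_le_mul (K := ⟨σ.length, hl⟩) fun s t => ?_).continuous
    rw [Real.dist_eq]
    exact dist_axis_le hσ s t
  · have h1 := hy.abs_sub_le_dist hX ⌊s⌋ ⌊t⌋
    have h2 := div_le_self (abs_nonneg (t - s)) (show 1 ≤ D + 2 * σ.length + 3 by linarith)
    have h3 : |t - s| ≤ |(⌊s⌋ : ℝ) - ⌊t⌋| + 1 := by
      have a1 := Int.floor_le s
      have a2 := Int.floor_le t
      have a3 := Int.lt_floor_add_one s
      have a4 := Int.lt_floor_add_one t
      have b1 := le_abs_self ((⌊s⌋ : ℝ) - ⌊t⌋)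
      have b2 := neg_abs_le ((⌊s⌋ : ℝ) - ⌊t⌋)
      rw [abs_le]
      constructor <;> linarith
    linarith [dist_triangle4 ((g ^ ⌊s⌋) σ.source) (axis g σ s) (axis g σ t) ((g ^ ⌊t⌋) σ.source),
      hfl s, hfl t, dist_comm (axis g σ t) ((g ^ ⌊t⌋) σ.source)]
  · have h1 := dist_axis_le hσ s t
    rw [abs_sub_comm] at h1
    have h2 := mul_le_mul_of_nonneg_right
      (show σ.length ≤ D + 2 * σ.length + 3 by linarith) (abs_nonneg (t - s))
    linarith
  · exact fun x => (hcon x).trans (ENNReal.ofReal_le_ofReal (by linarith))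
  · rw [← range_comp]
    have : (g ∘ axis g σ) = axis g σ ∘ fun t => t + 1 := funext fun t => (axis_add_one t).symm
    rw [this]
    exact (add_right_surjective (1 : ℝ)).range_comp _

/-! ### Contracting rays in proper spaces -/

theorem IsCoarseLine.mono {y : ℤ → X} {M M' : ℝ} {E : ℕ} (hy : IsCoarseLine K y M E)
    (h : M ≤ M') : IsCoarseLine K y M' E :=
  ⟨fun i => (hy.dist_le i).trans h, hy.add_le, hy.le_cdist⟩

open Filter Topology in
/-- In a proper space, longer and longer segments from a point subconverge to a ray. -/
theorem exists_ray_of_segments [ProperSpace X] {o : X} (σ : ℕ → GeodesicSegment X)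
    (hσ : ∀ n, (σ n).source = o) (hl : Tendsto (fun n => (σ n).length) atTop atTop) :
    ∃ α : ℝ≥0 → X, Isometry α ∧ α 0 = o ∧ ∀ (p : X) (R : ℝ),
      (∀ᶠ n in atTop, ∃ e ∈ (σ n).carrier, dist e p ≤ R) → ∃ t, dist (α t) p ≤ R := by
  -- Limits along one ultrafilter replace a diagonal extraction.
  set U : Ultrafilter ℕ := hyperfilter ℕ with hU
  have hUle : (U : Filter ℕ) ≤ atTop := by rw [← Nat.cofinite_eq_atTop]; exact hyperfilter_le_cofinite
  have hmem : ∀ (n : ℕ) (t : ℝ≥0), min (t : ℝ) (σ n).length ∈ Icc 0 (σ n).length := fun n t =>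
    ⟨le_min t.2 (σ n).length_nonneg, min_le_right _ _⟩
  have hlim : ∀ t : ℝ≥0, ∃ x, Tendsto (fun n => (σ n).toFun (min (t : ℝ) (σ n).length)) U (𝓝 x) := by
    intro t
    obtain ⟨x, -, hx⟩ := (isCompact_closedBall o (t : ℝ)).ultrafilter_le_nhds
      (U.map fun n => (σ n).toFun (min (t : ℝ) (σ n).length)) (by
        simp only [Ultrafilter.coe_map, le_principal_iff, mem_map]
        refine univ_mem' fun n => ?_
        simp only [mem_preimage, mem_closedBall]
        rw [dist_comm, ← hσ n, (σ n).dist_source (hmem n t).1 (hmem n t).2]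
        exact min_le_left _ _)
    exact ⟨x, hx⟩
  choose α hα using hlim
  have hlarge : ∀ t : ℝ≥0, ∀ᶠ n in (U : Filter ℕ), (t : ℝ) ≤ (σ n).length := fun t =>
    hUle (hl.eventually_ge_atTop _)
  refine ⟨α, Isometry.of_dist_eq fun s t => ?_, ?_, fun p R h => ?_⟩
  · refine tendsto_nhds_unique ((hα s).dist (hα t)) (tendsto_const_nhds.congr' ?_)
    filter_upwards [hlarge s, hlarge t] with n h1 h2
    rw [min_eq_left h1, min_eq_left h2, (σ n).dist_eq s ⟨s.2, h1⟩ t ⟨t.2, h2⟩]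
    rfl
  · refine tendsto_nhds_unique (hα 0) (tendsto_const_nhds.congr fun n => ?_)
    rw [NNReal.coe_zero, min_eq_left (σ n).length_nonneg, ← hσ n]
    rfl
  -- The parameters of points within R of p are at most d(o, p) + R, so they converge along the
  -- ultrafilter as well.
  · have h' : ∀ᶠ n in (U : Filter ℕ), ∃ t : ℝ, t ∈ Icc 0 (dist o p + R) ∧ t ≤ (σ n).length ∧
        dist ((σ n).toFun t) p ≤ R := by
      filter_upwards [hUle h] with n hn
      obtain ⟨_, ⟨t, ht, rfl⟩, h3⟩ := hn
      refine ⟨t, ⟨ht.1, ?_⟩, ht.2, h3⟩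
      have := (σ n).dist_source ht.1 ht.2
      rw [hσ n] at this
      linarith [dist_triangle_right o ((σ n).toFun t) p]
    obtain ⟨τ, hτ⟩ := h'.choice
    obtain ⟨t, ht, htlim⟩ := (isCompact_Icc (a := 0) (b := dist o p + R)).ultrafilter_le_nhds
      (U.map τ) (by
        simp only [Ultrafilter.coe_map, le_principal_iff, mem_map]
        filter_upwards [hτ] with n hn using hn.1)
    have htlim' : Tendsto τ U (𝓝 t) := htlim
    lift t to ℝ≥0 using ht.1
    refine ⟨t, ?_⟩
    have h4 : Tendsto (fun n => R + |τ n - t|) U (𝓝 (R + |(t : ℝ) - t|)) :=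
      tendsto_const_nhds.add ((htlim'.sub_const _).abs)
    rw [sub_self, abs_zero, add_zero] at h4
    refine le_of_tendsto_of_tendsto ((hα t).dist tendsto_const_nhds) h4 ?_
    filter_upwards [hτ, hlarge t] with n h5 h6
    rw [min_eq_left h6]
    have h7 := (σ n).dist_eq (τ n) ⟨h5.1.1, h5.2.1⟩ t ⟨t.2, h6⟩
    linarith [dist_triangle_left ((σ n).toFun t) p ((σ n).toFun (τ n)), h5.2.2]

/-- The segments from `y 0` to `y n` pass within a fixed radius of every intermediate `y i`, so the
limit ray does too; it then fellow-travels the half-line and inherits its contraction. -/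
theorem IsCoarseLine.hasStronglyContractingRay [ProperSpace X] (hX : IsGeodesicSpace X)
    {y : ℤ → X} {M : ℝ} {E : ℕ} (hy : IsCoarseLine K y M E) : HasStronglyContractingRay X := by
  have hM := hy.nonneg
  choose σ hσ1 hσ2 using fun n : ℕ => hX (y 0) (y n)
  set R := radius M E with hRdef
  have hR : 0 ≤ R := by rw [hRdef]; unfold radius; positivity
  have hI : (Ici (0 : ℤ)).OrdConnected := ordConnected_Ici
  have hl : Filter.Tendsto (fun n => (σ n).length) Filter.atTop Filter.atTop := by
    refine Filter.tendsto_atTop_mono (fun n => ?_)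
      (Filter.tendsto_atTop_add_const_right _ (-1) tendsto_natCast_atTop_atTop)
    have h1 := hy.abs_sub_le_dist hX 0 n
    rw [← hσ1 n, ← hσ2 n, (σ n).dist_source_target] at h1
    simp only [Int.cast_zero, Int.cast_natCast, zero_sub, abs_neg, Nat.abs_cast] at h1
    linarith
  obtain ⟨α, hα, hα0, hclose⟩ := exists_ray_of_segments σ hσ1 hl
  have hnear : ∀ i : ℕ, ∃ t, dist (α t) (y i) ≤ R := fun i => by
    refine hclose _ _ ?_
    filter_upwards [Filter.eventually_ge_atTop (i + gap M E)] with n hn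
    refine hy.exists_mem_carrier_dist_le hX hI (u := 0) (v := n) ?_ ?_ (by omega) (by omega)
    · rw [hσ1]; exact isCoarseProj_self y (by simp)
    · rw [hσ2]; exact isCoarseProj_self y (by simp)
  choose τ hτ using hnear
  have hdist : ∀ s t : ℝ≥0, dist (α s) (α t) = |(s : ℝ) - t| := fun s t => by
    rw [hα.dist_eq]; rfl
  refine ⟨α, hα, (hy.mono (M' := M + 3 * R) (by linarith)).exists_isContracting hX hI ⟨0, by simp⟩
    ?_ ?_⟩
  · intro j hj
    lift j to ℕ using hj
    exact ⟨_, ⟨τ j, rfl⟩, by rw [dist_comm]; linarith [hτ j]⟩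
  · rintro _ ⟨t, rfl⟩
    classical
    have hex : ∃ i : ℕ, t ≤ τ i := by
      obtain ⟨i, hi⟩ := exists_nat_ge ((t : ℝ) + 1 + R)
      refine ⟨i, ?_⟩
      have h1 := hy.abs_sub_le_dist hX 0 i
      have h2 := hdist 0 (τ i)
      simp only [Int.cast_zero, Int.cast_natCast, zero_sub, abs_neg, Nat.abs_cast, hα0,
        NNReal.coe_zero, NNReal.abs_eq] at h1 h2
      have h3 := dist_triangle (y 0) (α (τ i)) (y i)
      exact_mod_cast (show (t : ℝ) ≤ τ i by linarith [hτ i])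
    refine ⟨Nat.find hex, by simp, ?_⟩
    have h1 : (t : ℝ) ≤ τ (Nat.find hex) := by exact_mod_cast Nat.find_spec hex
    have h2 := hτ (Nat.find hex)
    have h3 := hdist t (τ (Nat.find hex))
    rw [abs_sub_comm, abs_of_nonneg (by linarith)] at h3
    have h4 := dist_triangle (α t) (α (τ (Nat.find hex))) (y (Nat.find hex))
    -- The index is the first whose nearby ray point lies beyond t. Consecutive nearby points are at
    -- most 2R + M apart on the ray; hence M + 3R in total.
    suffices (τ (Nat.find hex) : ℝ) - t ≤ 2 * R + M by linarith
    rcases Nat.eq_zero_or_pos (Nat.find hex) with h | h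
    · have h5 := hdist 0 (τ (Nat.find hex))
      rw [h] at h2
      rw [hα0, h] at h5
      simp only [NNReal.coe_zero, zero_sub, abs_neg, NNReal.abs_eq] at h5
      rw [dist_comm] at h5
      rw [h]
      push_cast at h2
      linarith [t.coe_nonneg]
    · have h5 : (τ (Nat.find hex - 1) : ℝ) < t := by
        exact_mod_cast not_le.1 (Nat.find_min hex (Nat.sub_lt h one_pos))
      have h6 := hdist (τ (Nat.find hex - 1)) (τ (Nat.find hex))
      rw [abs_sub_comm, abs_of_nonneg (by linarith)] at h6
      have h7 := hy.dist_le ((Nat.find hex - 1 : ℕ) : ℤ)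
      rw [show ((Nat.find hex - 1 : ℕ) : ℤ) + 1 = (Nat.find hex : ℕ) by omega] at h7
      have h8 := hτ (Nat.find hex - 1)
      linarith [dist_triangle4 (α (τ (Nat.find hex - 1))) (y (Nat.find hex - 1 : ℕ))
        (y (Nat.find hex)) (α (τ (Nat.find hex))), dist_comm (y (Nat.find hex)) (α (τ (Nat.find hex)))]

/-! ### Geodesics and contracting sets -/

theorem IsContracting.dist_le {Y : Set X} {D : ℝ} (hD : 0 ≤ D) (h : IsContracting D Y)
    {x z p q : X} (hz : dist x z < infDist x Y) (hp : p ∈ closestPoints Y x)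
    (hq : q ∈ closestPoints Y z) : dist p q ≤ D := by
  rw [dist_comm] at hz
  have h1 : x ∈ ball x (infDist x Y) := mem_ball_self (dist_nonneg.trans_lt hz)
  have h2 := (edist_le_ediam_of_mem (mem_biUnion h1 hp) (mem_biUnion (mem_ball.2 hz) hq)).trans (h x)
  rwa [edist_dist, ENNReal.ofReal_le_ofReal_iff hD] at h2

section

variable {Y : Set X} {D : ℝ}

/-- A stretch of length 4D + 3 lies in the ball around its later end that misses Y, so it moves the
projection by at most D: a contraction by a factor 4. Since the balls are centred at later ends,
nothing is asked at time a. -/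
theorem dist_closestPoints_le_of_far (hD : 1 ≤ D) (hY : IsContracting D Y)
    (hne : ∀ x, (closestPoints Y x).Nonempty) (γ : GeodesicSegment X) {a b : ℝ} (ha : 0 ≤ a)
    (hab : a < b) (hb : b ≤ γ.length)
    (hfar : ∀ t, a < t → t ≤ b → 4 * D + 4 ≤ infDist (γ.toFun t) Y) {p q : X}
    (hp : p ∈ closestPoints Y (γ.toFun a)) (hq : q ∈ closestPoints Y (γ.toFun b)) :
    dist p q ≤ (b - a) / 4 + D := by
  have key : ∀ n : ℕ, ∀ b q, a < b → b ≤ γ.length →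
      (∀ t, a < t → t ≤ b → 4 * D + 4 ≤ infDist (γ.toFun t) Y) → q ∈ closestPoints Y (γ.toFun b) →
      b - a ≤ (n + 1) * (4 * D + 3) → dist q p ≤ (n + 1) * D := by
    intro n
    induction n with
    | zero =>
      intro b q hab hb hfar hq h
      have h1 := hY.dist_le (by linarith) (x := γ.toFun b) (z := γ.toFun a) (by
        rw [dist_comm, γ.dist_of_le ha hab.le hb]
        push_cast at h
        linarith [hfar b hab le_rfl]) hq hp
      simpa using h1
    | succ n ih =>
      intro b q hab hb hfar hq h
      push_cast at h ⊢
      rcases le_or_gt (b - a) (4 * D + 3) with h' | h'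
      · have h1 := hY.dist_le (by linarith) (x := γ.toFun b) (z := γ.toFun a) (by
          rw [dist_comm, γ.dist_of_le ha hab.le hb]
          linarith [hfar b hab le_rfl]) hq hp
        have : (0 : ℝ) ≤ n * D := by positivity
        linarith
      · obtain ⟨q', hq'⟩ := hne (γ.toFun (b - (4 * D + 3)))
        have h1 := ih (b - (4 * D + 3)) q' (by linarith) (by linarith)
          (fun t h1 h2 => hfar t h1 (by linarith)) hq' (by linarith)
        have h2 := hY.dist_le (by linarith) (x := γ.toFun b) (z := γ.toFun (b - (4 * D + 3))) (by
          rw [dist_comm, γ.dist_of_le (by linarith) (by linarith) hb]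
          linarith [hfar b hab le_rfl]) hq hq'
        linarith [dist_triangle q q' p]
  have hpos : 0 < 4 * D + 3 := by linarith
  have h1 := key (⌈(b - a) / (4 * D + 3)⌉₊ - 1) b q hab hb hfar hq
  have h2 : 0 < ⌈(b - a) / (4 * D + 3)⌉₊ := Nat.ceil_pos.2 (div_pos (by linarith) hpos)
  rw [Nat.cast_sub h2] at h1
  simp only [Nat.cast_one, sub_add_cancel] at h1
  have h3 := h1 ((div_le_iff₀ hpos).1 (Nat.le_ceil _))
  have h4 := (Nat.ceil_lt_add_one (div_nonneg (sub_nonneg.2 hab.le) hpos.le)).le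
  rw [dist_comm]
  refine h3.trans ((mul_le_mul_of_nonneg_right h4 (by linarith)).trans ?_)
  have h5 : (b - a) / (4 * D + 3) * D ≤ (b - a) / 4 := by
    rw [div_mul_eq_mul_div, div_le_div_iff₀ hpos (by norm_num)]
    nlinarith
  linarith

/-- A geodesic whose endpoints have far apart projections to a contracting set passes near the
projections of its endpoints. -/
theorem exists_mem_carrier_dist_target_le (hD : 1 ≤ D) (hY : IsContracting D Y)
    (hne : ∀ x, (closestPoints Y x).Nonempty) (γ : GeodesicSegment X) {p q : X}
    (hp : p ∈ closestPoints Y γ.source) (hq : q ∈ closestPoints Y γ.target)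
    (hpq : 8 * D + 6 < dist p q) : ∃ e ∈ γ.carrier, dist e q ≤ 8 * D + 6 := by
  have hl := γ.length_nonneg
  have hcont : ContinuousOn (fun t => infDist (γ.toFun t) Y) (Icc 0 γ.length) :=
    (continuous_infDist_pt Y).comp_continuousOn γ.continuousOn
  have hcl : IsCompact (Icc 0 γ.length ∩ (fun t => infDist (γ.toFun t) Y) ⁻¹' Iic (4 * D + 4)) :=
    isCompact_Icc.of_isClosed_subset
      (hcont.preimage_isClosed_of_isClosed isClosed_Icc isClosed_Iic) inter_subset_left
  have hpq' : dist γ.source γ.target = γ.length := γ.dist_source_target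
  have hD0 : 0 ≤ D := by linarith
  rcases eq_empty_or_nonempty
      (Icc 0 γ.length ∩ (fun t => infDist (γ.toFun t) Y) ⁻¹' Iic (4 * D + 4)) with h | h
  -- If γ stays far from Y, it is cut at distance d(·, Y) - 1 from each end. The projection moves by
  -- at most D on each outer piece and by a quarter of the length plus D on a remaining middle
  -- piece, too little for the gap between p and q.
  · exfalso
    have hfar : ∀ t, 0 ≤ t → t ≤ γ.length → 4 * D + 4 < infDist (γ.toFun t) Y := by
      intro t h0 h1
      by_contra hcon
      exact (h ▸ (⟨⟨h0, h1⟩, not_lt.1 hcon⟩ :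
        t ∈ Icc 0 γ.length ∩ (fun t => infDist (γ.toFun t) Y) ⁻¹' Iic (4 * D + 4)) : t ∈ (∅ : Set ℝ))
    have hp0 : 4 * D + 4 < infDist γ.source Y := hfar 0 le_rfl hl
    have hq0 : 4 * D + 4 < infDist γ.target Y := hfar _ hl le_rfl
    have e1 := hp.2
    have e2 := hq.2
    rcases le_or_gt γ.length (infDist γ.source Y - 1) with h1 | h1
    · have := hY.dist_le hD0 (x := γ.source) (z := γ.target) (by linarith) hp hq
      linarith
    obtain ⟨p', hp'⟩ := hne (γ.toFun (infDist γ.source Y - 1))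
    have f1 := hY.dist_le hD0 (x := γ.source) (z := γ.toFun (infDist γ.source Y - 1))
      (by rw [γ.dist_source (by linarith) h1.le]; linarith) hp hp'
    rcases le_or_gt (γ.length - (infDist γ.target Y - 1)) (infDist γ.source Y - 1) with h2 | h2
    · have f2 := hY.dist_le hD0 (x := γ.target) (z := γ.toFun (infDist γ.source Y - 1))
        (by rw [dist_comm, γ.dist_target (by linarith) h1.le]; linarith) hq hp'
      linarith [dist_triangle_right p q p']
    · obtain ⟨q', hq'⟩ := hne (γ.toFun (γ.length - (infDist γ.target Y - 1)))
      have f2 := hY.dist_le hD0 (x := γ.target)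
        (z := γ.toFun (γ.length - (infDist γ.target Y - 1)))
        (by rw [dist_comm, γ.dist_target (by linarith) (by linarith)]; linarith) hq hq'
      have f3 := dist_closestPoints_le_of_far hD hY hne γ (by linarith) h2 (by linarith)
        (fun t h3 h4 => (hfar t (by linarith) (by linarith)).le) hp' hq'
      linarith [dist_triangle4 p p' q' q, dist_comm q q', dist_triangle4 γ.source p q γ.target,
        dist_comm q γ.target]
  -- The last point within 4D + 4 of Y serves: beyond it the projection moves slowly, so its own
  -- projection is within 4D + 2 of q.
  · obtain ⟨a, ⟨⟨ha0, hal⟩, ha⟩, hmax⟩ := hcl.exists_isGreatest h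
    simp only [mem_preimage, mem_Iic] at ha
    have hfar : ∀ t, a < t → t ≤ γ.length → 4 * D + 4 < infDist (γ.toFun t) Y := by
      intro t h0 h1
      by_contra hcon
      exact absurd (hmax ⟨⟨ha0.trans h0.le, h1⟩, not_lt.1 hcon⟩) (not_le.2 h0)
    refine ⟨γ.toFun a, γ.apply_mem ha0 hal, ?_⟩
    rcases hal.eq_or_lt with h1 | h1
    · have e1 : γ.toFun a = γ.target := by rw [h1]; rfl
      rw [e1] at ha ⊢
      linarith [hq.2]
    have hq0 : 4 * D + 4 < infDist γ.target Y := hfar _ h1 le_rfl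
    obtain ⟨a', ha'⟩ := hne (γ.toFun a)
    have e1 := ha'.2
    have e2 := hq.2
    rcases le_or_gt (γ.length - a) (infDist γ.target Y - 1) with h2 | h2
    · have := hY.dist_le hD0 (x := γ.target) (z := γ.toFun a)
        (by rw [dist_comm, γ.dist_target ha0 hal]; linarith) hq ha'
      linarith [dist_triangle_right (γ.toFun a) q a']
    · obtain ⟨q', hq'⟩ := hne (γ.toFun (γ.length - (infDist γ.target Y - 1)))
      have f2 := hY.dist_le hD0 (x := γ.target)
        (z := γ.toFun (γ.length - (infDist γ.target Y - 1)))
        (by rw [dist_comm, γ.dist_target (by linarith) (by linarith)]; linarith) hq hq'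
      have f3 := dist_closestPoints_le_of_far hD hY hne γ ha0
        (show a < γ.length - (infDist γ.target Y - 1) by linarith) (by linarith)
        (fun t h3 h4 => (hfar t (by linarith) (by linarith)).le) ha' hq'
      have f4 := γ.dist_target ha0 hal
      linarith [dist_triangle (γ.toFun a) a' q, dist_triangle_right a' q q',
        dist_triangle4 (γ.toFun a) a' q γ.target, dist_comm q γ.target]

end

/-! ### Contracting quasi-geodesics -/

/-- A contracting quasi-geodesic, parametrised by an order-connected subset `S` of the real line,
that has a closest point for each point of `X`. -/
structure IsContractingPath (S : Set ℝ) (γ : ℝ → X) (C D : ℝ) : Prop where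
  ordConnected : S.OrdConnected
  one_le_C : 1 ≤ C
  one_le_D : 1 ≤ D
  le_dist : ∀ s ∈ S, ∀ t ∈ S, |t - s| / C - C ≤ dist (γ s) (γ t)
  dist_le : ∀ s ∈ S, ∀ t ∈ S, dist (γ s) (γ t) ≤ C * |t - s| + C
  isContracting : IsContracting D (γ '' S)
  exists_closest : ∀ x, (closestPoints (γ '' S) x).Nonempty

/-- `γ s` is a closest point to `x` on the path. -/
def IsProj (S : Set ℝ) (γ : ℝ → X) (x : X) (s : ℝ) : Prop :=
  s ∈ S ∧ γ s ∈ closestPoints (γ '' S) x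

theorem isProj_self {S : Set ℝ} {γ : ℝ → X} {s : ℝ} (hs : s ∈ S) : IsProj S γ (γ s) s :=
  ⟨hs, mem_image_of_mem γ hs, by rw [dist_self, infDist_zero_of_mem (mem_image_of_mem γ hs)]⟩

namespace IsContractingPath

variable {S : Set ℝ} {γ : ℝ → X} {C D : ℝ}

/-- Reversing the path lets each one-sided statement below serve on both sides. -/
theorem neg (h : IsContractingPath S γ C D) : IsContractingPath (-S) (fun t => γ (-t)) C D := by
  have him : (fun t => γ (-t)) '' (-S) = γ '' S := by
    ext p; constructor
    · rintro ⟨t, ht, rfl⟩; exact ⟨-t, ht, rfl⟩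
    · rintro ⟨t, ht, rfl⟩; exact ⟨-t, by simpa using ht, by simp⟩
  refine ⟨⟨fun a ha b hb t ht => ?_⟩, h.one_le_C, h.one_le_D, fun s hs t ht => ?_,
    fun s hs t ht => ?_, by rw [him]; exact h.isContracting, by rw [him]; exact h.exists_closest⟩
  · exact h.ordConnected.out hb ha ⟨neg_le_neg ht.2, neg_le_neg ht.1⟩
  · have := h.le_dist _ hs _ ht
    rwa [neg_sub_neg, abs_sub_comm] at this
  · have := h.dist_le _ hs _ ht
    rwa [neg_sub_neg, abs_sub_comm] at this

theorem isProj_neg {x : X} {s : ℝ} (hs : IsProj S γ x s) :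
    IsProj (-S) (fun t => γ (-t)) x (-s) := by
  have him : (fun t => γ (-t)) '' (-S) = γ '' S := by
    ext p; constructor
    · rintro ⟨t, ht, rfl⟩; exact ⟨-t, ht, rfl⟩
    · rintro ⟨t, ht, rfl⟩; exact ⟨-t, by simpa using ht, by simp⟩
  refine ⟨by simpa using hs.1, ?_⟩
  rw [him]
  simpa using hs.2

variable (h : IsContractingPath S γ C D)
include h

theorem C_pos : 0 < C := zero_lt_one.trans_le h.one_le_C

theorem exists_isProj (x : X) : ∃ s, IsProj S γ x s := by
  obtain ⟨p, hp⟩ := h.exists_closest x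
  obtain ⟨s, hs, rfl⟩ := hp.1
  exact ⟨s, hs, hp⟩

theorem abs_sub_le {s t A : ℝ} (hs : s ∈ S) (ht : t ∈ S) (hA : dist (γ s) (γ t) ≤ A) :
    |t - s| ≤ C * (A + C) := by
  have h1 := h.le_dist s hs t ht
  have h2 : |t - s| / C ≤ A + C := by linarith
  rw [div_le_iff₀ h.C_pos] at h2
  linarith

/-- Either contraction applies, or x is within 1 of the path and both projections are close to their
points; the latter case gives the 4. -/
theorem abs_sub_le_of_dist_le_one {x z : X} {s t : ℝ} (hxz : dist x z ≤ 1) (hs : IsProj S γ x s)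
    (ht : IsProj S γ z t) : |s - t| ≤ C * (D + 4 + C) := by
  rw [abs_sub_comm]
  refine h.abs_sub_le hs.1 ht.1 ?_
  have hD := h.one_le_D
  rcases lt_or_ge (dist x z) (infDist x (γ '' S)) with h1 | h1
  · linarith [h.isContracting.dist_le (by linarith) h1 hs.2 ht.2]
  · have h2 := infDist_le_infDist_add_dist (s := γ '' S) (x := z) (y := x)
    linarith [dist_triangle4 (γ s) x z (γ t), hs.2.2, ht.2.2, dist_comm (γ s) x, dist_comm z x]

omit h in
theorem exists_of_relation {P : ℝ → ℝ → Prop} {l J a b u : ℝ} (hl : 0 ≤ l)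
    (hex : ∀ t, ∃ s, P t s)
    (hP : ∀ t ∈ Icc 0 l, ∀ t' ∈ Icc 0 l, |t - t'| ≤ 1 → ∀ s s', P t s → P t' s' → |s - s'| ≤ J)
    (ha : P 0 a) (hb : P l b) (hau : a ≤ u) (hub : u ≤ b) :
    ∃ t ∈ Icc 0 l, ∃ s, P t s ∧ |s - u| ≤ J := by
  classical
  rcases hl.eq_or_lt with rfl | hl'
  · refine ⟨0, ⟨le_rfl, le_rfl⟩, a, ha, ?_⟩
    have := hP 0 ⟨le_rfl, le_rfl⟩ 0 ⟨le_rfl, le_rfl⟩ (by simp) a b ha hb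
    rw [abs_le] at this ⊢
    constructor <;> linarith [this.1, this.2]
  · choose f hf using hex
    -- Projections are not unique, so the chosen one must be overridden by a and b at the two ends.
    set φ : ℝ → ℝ := Function.update (Function.update f 0 a) l b with hφ
    have hφP : ∀ t, P t (φ t) := by
      intro t
      rcases eq_or_ne t l with rfl | h1
      · simpa [hφ] using hb
      · rw [hφ, Function.update_of_ne h1]
        rcases eq_or_ne t 0 with rfl | h2
        · simpa using ha
        · rw [Function.update_of_ne h2]; exact hf t
    obtain ⟨t, ht, hu⟩ := exists_abs_sub_le_of_le_of_le (φ := φ) (u := u) hl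
      (fun s hs t ht hst => hP s hs t ht hst _ _ (hφP s) (hφP t))
      (by rw [hφ, Function.update_of_ne hl'.ne]; simpa using hau) (by simpa [hφ] using hub)
    exact ⟨t, ht, φ t, hφP t, hu⟩

omit h in
/-- The distance of projections from which on geodesics follow the path. -/
def followGap (C D : ℝ) : ℝ := C * (D + 4 + C) + C * (8 * D + 6 + C) + 1

omit h in
/-- The distance within which geodesics follow the path. -/
def followRadius (C D : ℝ) : ℝ := 8 * D + 6 + C * (C * (D + 4 + C)) + C

theorem followRadius_pos : 0 < followRadius C D := by
  have := h.C_pos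
  have := h.one_le_D
  unfold followRadius; positivity

theorem followGap_pos : 0 < followGap C D := by
  have := h.C_pos
  have := h.one_le_D
  unfold followGap; positivity

/-- By the discrete intermediate value theorem some point of τ projects close to `γ u`. Up to this
point the projection has moved far, so τ passes close to it. -/
theorem exists_follow {τ : GeodesicSegment X} {a b u : ℝ} (ha : IsProj S γ τ.source a)
    (hb : IsProj S γ τ.target b) (hau : a ≤ u) (hub : u ≤ b) (hu : followGap C D ≤ u - a) :
    ∃ e ∈ τ.carrier, dist e (γ u) ≤ followRadius C D := by
  have hD := h.one_le_D
  have hC := h.C_pos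
  have huS : u ∈ S := h.ordConnected.out ha.1 hb.1 ⟨hau, hub⟩
  obtain ⟨t, ht, s, hs, hsu⟩ := exists_of_relation (P := fun t s => IsProj S γ (τ.toFun t) s)
    (J := C * (D + 4 + C)) τ.length_nonneg (fun t => h.exists_isProj _)
    (fun t ht t' ht' htt s s' hs hs' => h.abs_sub_le_of_dist_le_one
      (by rwa [τ.dist_eq t ht t' ht']) hs hs') ha hb hau hub
  have hfar : 8 * D + 6 < dist (γ a) (γ s) := by
    by_contra hcon
    have h1 := h.abs_sub_le ha.1 hs.1 (not_lt.1 hcon)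
    unfold followGap at hu
    linarith [le_abs_self (s - a), neg_abs_le (s - u)]
  obtain ⟨e, he, h1⟩ := exists_mem_carrier_dist_target_le hD h.isContracting h.exists_closest
    (τ.sub 0 t le_rfl ht.1 ht.2) (p := γ a) (q := γ s)
    (by rw [GeodesicSegment.sub_source]; exact ha.2)
    (by rw [GeodesicSegment.sub_target]; exact hs.2) hfar
  refine ⟨e, τ.sub_carrier_subset _ _ _ he, ?_⟩
  have h2 := h.dist_le s hs.1 u huS
  have h3 := mul_le_mul_of_nonneg_left hsu hC.le
  rw [abs_sub_comm] at h2
  unfold followRadius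
  linarith [dist_triangle e (γ s) (γ u)]

theorem exists_follow_of_target {τ : GeodesicSegment X} {a b u : ℝ} (ha : IsProj S γ τ.source a)
    (hb : IsProj S γ τ.target b) (hau : a ≤ u) (hub : u ≤ b) (hu : followGap C D ≤ b - u) :
    ∃ e ∈ τ.carrier, dist e (γ u) ≤ followRadius C D := by
  obtain ⟨e, he, he'⟩ := h.neg.exists_follow (τ := τ.rev) (a := -b) (b := -a) (u := -u)
    (by rw [τ.rev_source]; exact isProj_neg hb) (by rw [τ.rev_target]; exact isProj_neg ha)
    (by linarith) (by linarith) (by linarith)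
  exact ⟨e, by simpa using he, by simpa using he'⟩

omit h in
/-- The distance from the middle at which geodesic extensions keep apart. -/
def sideGap (C D : ℝ) : ℝ := 2 * followGap C D + C * (2 * followRadius C D + C)

omit h in
/-- The distance from the middle beyond which geodesic extensions do not come back. -/
def farGap (C D : ℝ) : ℝ :=
  sideGap C D + followGap C D + C * (6 * followRadius C D + C) + 1

theorem sideGap_pos : 0 < sideGap C D := by
  have := h.C_pos
  have := h.followGap_pos
  have := h.followRadius_pos
  unfold sideGap; positivity

theorem farGap_pos : 0 < farGap C D := by
  have := h.C_pos
  have := h.followGap_pos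
  have := h.followRadius_pos
  have := h.sideGap_pos
  unfold farGap; positivity

/-- Otherwise τ would already follow the path at u - `farGap` before reaching z, and the rest of τ,
which contains z, would be too short. -/
theorem proj_le_of_far {τ : GeodesicSegment X} {u a s : ℝ} {z : X} (huS : u ∈ S)
    (hm : dist τ.target (γ u) ≤ followRadius C D) (ha : IsProj S γ τ.source a)
    (hau : a ≤ u - farGap C D - followGap C D) (hz : z ∈ τ.carrier)
    (hd : 2 * followRadius C D + C * farGap C D + C < dist z τ.target) (hs : IsProj S γ z s) :
    s ≤ u - farGap C D := by
  by_contra hcon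
  push Not at hcon
  have h1 := h.followGap_pos
  have h2 := h.farGap_pos
  obtain ⟨t, ht, rfl⟩ := hz
  obtain ⟨e, he, he'⟩ := h.exists_follow (τ := τ.sub 0 t le_rfl ht.1 ht.2) (a := a) (b := s)
    (u := u - farGap C D) (by rw [GeodesicSegment.sub_source]; exact ha)
    (by rw [GeodesicSegment.sub_target]; exact hs) (by linarith) hcon.le (by linarith)
  obtain ⟨t', h0, h1', rfl⟩ := τ.exists_of_mem_sub_carrier _ _ _ he
  have h3 := τ.dist_target ht.1 ht.2
  have h4 := τ.dist_target h0 (h1'.trans ht.2)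
  have h5 := h.dist_le _ (h.ordConnected.out ha.1 huS ⟨by linarith, by linarith⟩ :
    u - farGap C D ∈ S) u huS
  rw [sub_sub_cancel, abs_of_pos h2] at h5
  linarith [dist_triangle4 (τ.toFun t') (γ (u - farGap C D)) (γ u) τ.target,
    dist_comm (γ u) τ.target]

/-- Controls arbitrary prolongations of a segment. If the source came back, τ would visit the same
point of the path before and after z; as τ is geodesic, z would be close to that point and project
close to it. -/
theorem proj_source_le {τ : GeodesicSegment X} {u a s : ℝ} {z : X} (huS : u ∈ S)
    (hm : dist τ.target (γ u) ≤ followRadius C D) (hz : z ∈ τ.carrier) (hs : IsProj S γ z s)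
    (hsu : s ≤ u - farGap C D) (ha : IsProj S γ τ.source a) : a ≤ u - sideGap C D := by
  by_contra hcon
  push Not at hcon
  have hT := h.followGap_pos
  have hr := h.followRadius_pos
  have hC := h.C_pos
  have hfar : farGap C D = sideGap C D + followGap C D + C * (6 * followRadius C D + C) + 1 := rfl
  have hside : sideGap C D = 2 * followGap C D + C * (2 * followRadius C D + C) := rfl
  have hpos : 0 < C * (6 * followRadius C D + C) := by positivity
  obtain ⟨b, hb⟩ := h.exists_isProj τ.target
  have hbu : |u - b| ≤ C * (2 * followRadius C D + C) := by
    refine h.abs_sub_le hb.1 huS ?_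
    have h1 := infDist_le_dist_of_mem (x := τ.target) (mem_image_of_mem γ huS)
    rw [← hb.2.2] at h1
    linarith [dist_triangle_left (γ b) (γ u) τ.target]
  have hbu' := le_abs_self (u - b)
  set v := u - sideGap C D - followGap C D with hv
  have hvS : v ∈ S := h.ordConnected.out hs.1 huS ⟨by linarith, by linarith [h.sideGap_pos]⟩
  obtain ⟨t, ht, rfl⟩ := hz
  obtain ⟨e, he, he'⟩ := h.neg.exists_follow (τ := τ.sub 0 t le_rfl ht.1 ht.2) (a := -a) (b := -s)
    (u := -v) (by rw [GeodesicSegment.sub_source]; exact isProj_neg ha)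
    (by rw [GeodesicSegment.sub_target]; exact isProj_neg hs) (by linarith) (by linarith)
    (by linarith)
  simp only [neg_neg] at he'
  obtain ⟨e₂, he₂, he₂'⟩ := h.exists_follow_of_target (τ := τ.sub t τ.length ht.1 ht.2 le_rfl)
    (a := s) (b := b) (u := v) (by rw [GeodesicSegment.sub_source]; exact hs)
    (by rw [GeodesicSegment.sub_target]; exact hb) (by linarith) (by linarith) (by linarith)
  obtain ⟨t₁, k0, k1, rfl⟩ := τ.exists_of_mem_sub_carrier _ _ _ he
  obtain ⟨t₂, l0, l1, rfl⟩ := τ.exists_of_mem_sub_carrier _ _ _ he₂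
  have d1 := τ.dist_of_le k0 k1 ht.2
  have d2 := τ.dist_of_le k0 (k1.trans l0) l1
  have d3 := dist_triangle_right (τ.toFun t₁) (τ.toFun t₂) (γ v)
  have d4 : dist (τ.toFun t) (γ v) ≤ 3 * followRadius C D := by
    linarith [dist_triangle_left (τ.toFun t) (γ v) (τ.toFun t₁)]
  have d5 : dist (γ s) (γ v) ≤ 6 * followRadius C D := by
    have h1 := infDist_le_dist_of_mem (x := τ.toFun t) (mem_image_of_mem γ hvS)
    rw [← hs.2.2] at h1
    linarith [dist_triangle_left (γ s) (γ v) (τ.toFun t)]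
  have d6 := h.abs_sub_le hs.1 hvS d5
  linarith [le_abs_self (v - s)]

omit h in
/-- The thinness of geodesics that follow the path. -/
def thinRadius (C D : ℝ) : ℝ := 2 * followRadius C D + C * followGap C D + C

theorem thinRadius_pos : 0 < thinRadius C D := by
  have := h.C_pos
  have := h.followGap_pos
  have := h.followRadius_pos
  unfold thinRadius; positivity

/-- The projections of the three sides together run from one side of u to the other. Whichever side
crosses u follows the path there; if γ₃ starts to cross too close to u, γ₄ follows the path up to
that place. -/
theorem exists_mem_closedBall {γ₂ γ₃ γ₄ : GeodesicSegment X} {m : X} {u a b : ℝ} (huS : u ∈ S)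
    (hm : dist m (γ u) ≤ followRadius C D) (h23 : γ₂.target = γ₃.source)
    (h34 : γ₃.target = γ₄.source) (ha : IsProj S γ γ₄.target a) (hb : IsProj S γ γ₂.source b)
    (hau : a ≤ u - sideGap C D) (hub : u + sideGap C D ≤ b) :
    ((γ₂.carrier ∪ γ₃.carrier ∪ γ₄.carrier) ∩ closedBall m (thinRadius C D)).Nonempty := by
  have hT := h.followGap_pos
  have hr := h.followRadius_pos
  have hC := h.C_pos
  have hside : sideGap C D = 2 * followGap C D + C * (2 * followRadius C D + C) := rfl
  have hpos : 0 < C * (2 * followRadius C D + C) := by positivity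
  have hthin : thinRadius C D = 2 * followRadius C D + C * followGap C D + C := rfl
  have hpos' : 0 < C * followGap C D := by positivity
  have near : ∀ e, dist e (γ u) ≤ followRadius C D → e ∈ closedBall m (thinRadius C D) := by
    intro e he
    rw [mem_closedBall]
    linarith [dist_triangle_right e m (γ u)]
  obtain ⟨w, hw⟩ := h.exists_isProj γ₄.source
  obtain ⟨z, hz⟩ := h.exists_isProj γ₂.target
  rcases le_or_gt u w with h1 | h1
  · obtain ⟨e, he, he'⟩ := h.exists_follow (τ := γ₄.rev) (a := a) (b := w) (u := u)
      (by simpa using ha) (by simpa using hw) (by linarith) h1 (by linarith)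
    exact ⟨e, .inr (by simpa using he), near e he'⟩
  rcases le_or_gt z u with h2 | h2
  · obtain ⟨e, he, he'⟩ := h.exists_follow_of_target (τ := γ₂.rev) (a := z) (b := b) (u := u)
      (by simpa using hz) (by simpa using hb) h2 (by linarith) (by linarith)
    exact ⟨e, .inl (.inl (by simpa using he)), near e he'⟩
  rcases le_or_gt (followGap C D) (u - w) with h3 | h3
  · obtain ⟨e, he, he'⟩ := h.exists_follow (τ := γ₃.rev) (a := w) (b := z) (u := u)
      (by simpa [h34] using hw) (by simpa [← h23] using hz) h1.le h2.le h3
    exact ⟨e, .inl (.inr (by simpa using he)), near e he'⟩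
  · obtain ⟨e, he, he'⟩ := h.exists_follow (τ := γ₄.rev) (a := a) (b := w) (u := w)
      (by simpa using ha) (by simpa using hw) (by linarith) le_rfl (by linarith)
    refine ⟨e, .inr (by simpa using he), ?_⟩
    have h4 := h.dist_le w hw.1 u huS
    rw [abs_of_pos (by linarith)] at h4
    have h5 := mul_le_mul_of_nonneg_left h3.le hC.le
    rw [mem_closedBall]
    linarith [dist_triangle4 e (γ w) (γ u) m, dist_comm (γ u) m]

/-- A geodesic whose endpoints have far apart projections contains long thin segments. -/
theorem exists_isThin {L : ℝ} (hL : 2 * (2 * followRadius C D + C * farGap C D + C) < L)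
    {τ : GeodesicSegment X} {a b : ℝ} (ha : IsProj S γ τ.source a) (hb : IsProj S γ τ.target b)
    (hab : 2 * (farGap C D + followGap C D) + 2 * (C * (L + 2 * followRadius C D + C)) ≤ b - a) :
    ∃ τ' : GeodesicSegment X, τ'.IsSubsegment τ ∧ τ'.length = L ∧ τ'.IsThin (thinRadius C D) := by
  have hT := h.followGap_pos
  have hr := h.followRadius_pos
  have hC := h.C_pos
  have hF := h.farGap_pos
  have hLpos : 0 < L := by
    have : 0 < 2 * (2 * followRadius C D + C * farGap C D + C) := by positivity
    linarith
  have hpos : 0 < C * (L + 2 * followRadius C D + C) := by positivity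
  set u := (a + b) / 2 with hu
  have hua : u - a = (b - a) / 2 := by rw [hu]; ring
  have hbu : b - u = (b - a) / 2 := by rw [hu]; ring
  have huS : u ∈ S := h.ordConnected.out ha.1 hb.1 ⟨by linarith, by linarith⟩
  obtain ⟨m, ⟨t, ht, rfl⟩, hm⟩ := h.exists_follow ha hb (u := u) (by linarith) (by linarith)
    (by linarith)
  have far : ∀ (x : X) (s : ℝ), IsProj S γ x s → C * (L + 2 * followRadius C D + C) ≤ |u - s| →
      L / 2 ≤ dist x (τ.toFun t) := by
    intro x s hs hsu
    have h1 := h.le_dist s hs.1 u huS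
    have h2 : L + 2 * followRadius C D + C ≤ |u - s| / C := by
      rw [le_div_iff₀ hC]; linarith
    have h3 := infDist_le_dist_of_mem (x := x) (mem_image_of_mem γ huS)
    rw [← hs.2.2] at h3
    linarith [dist_triangle_left (γ s) (γ u) x, dist_triangle x (τ.toFun t) (γ u)]
  have ht1 : L / 2 ≤ t := by
    rw [← τ.dist_source ht.1 ht.2]
    exact far _ a ha (by rw [abs_of_nonneg (by linarith)]; linarith)
  have ht2 : t + L / 2 ≤ τ.length := by
    have h1 := far _ b hb (by rw [abs_sub_comm, abs_of_nonneg (by linarith)]; linarith)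
    rw [dist_comm, τ.dist_target ht.1 ht.2] at h1
    linarith
  refine ⟨τ.sub (t - L / 2) (t + L / 2) (by linarith) (by linarith) ht2, τ.sub_isSubsegment _ _ _,
    by simp only [GeodesicSegment.sub]; ring, ?_⟩
  have hmid : (τ.sub (t - L / 2) (t + L / 2) (by linarith) (by linarith) ht2).midpoint =
      τ.toFun t := by
    simp only [GeodesicSegment.midpoint, GeodesicSegment.sub]
    congr 1; ring
  -- The side γ₁ agrees with τ only on the segment, so its ends must be controlled separately:
  -- `proj_le_of_far` locates the ends of the segment on τ, and `proj_source_le` carries this to the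
  -- ends of γ₁.
  intro γ₁ γ₂ γ₃ γ₄ h12 h23 h34 h41 ⟨c, hc, hcl, hct⟩
  rw [hmid]
  simp only [GeodesicSegment.sub] at hcl hct
  have E : ∀ s, 0 ≤ s → s ≤ L → γ₁.toFun (c + s) = τ.toFun (t - L / 2 + s) := fun s h0 h1 =>
    (hct s ⟨h0, by linarith⟩).symm
  have E0 : γ₁.toFun c = τ.toFun (t - L / 2) := by simpa using E 0 le_rfl hLpos.le
  have E1 : γ₁.toFun (c + L / 2) = τ.toFun t := by
    rw [E _ (by linarith) (by linarith)]; congr 1; ring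
  have E2 : γ₁.toFun (c + L) = τ.toFun (t + L / 2) := by
    rw [E _ hLpos.le le_rfl]; congr 1; ring
  obtain ⟨x, hx⟩ := h.exists_isProj γ₁.source
  obtain ⟨y, hy⟩ := h.exists_isProj γ₁.target
  obtain ⟨p, hp⟩ := h.exists_isProj (τ.toFun (t - L / 2))
  obtain ⟨q, hq⟩ := h.exists_isProj (τ.toFun (t + L / 2))
  have p1 : p ≤ u - farGap C D := by
    refine h.proj_le_of_far (τ := τ.sub 0 t le_rfl ht.1 ht.2) huS
      (by rwa [GeodesicSegment.sub_target]) (by rw [GeodesicSegment.sub_source]; exact ha)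
      (by linarith) (τ.mem_sub_carrier _ _ _ (by linarith) (by linarith)) ?_ hp
    rw [GeodesicSegment.sub_target, τ.dist_of_le (by linarith) (by linarith) ht.2]
    linarith
  have p2 : x ≤ u - sideGap C D := by
    refine h.proj_source_le
      (τ := γ₁.sub 0 (c + L / 2) le_rfl (by linarith) (by linarith)) huS
      (by rwa [GeodesicSegment.sub_target, E1])
      (γ₁.mem_sub_carrier _ _ _ hc (by linarith)) (by rw [E0]; exact hp) p1
      (by rw [GeodesicSegment.sub_source]; exact hx)
  have q1 : -q ≤ -u - farGap C D := by
    refine h.neg.proj_le_of_far (τ := (τ.sub t τ.length ht.1 ht.2 le_rfl).rev) (by simpa using huS)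
      (by simpa using hm)
      (by rw [GeodesicSegment.rev_source, GeodesicSegment.sub_target]; exact isProj_neg hb)
      (by linarith)
      (by rw [GeodesicSegment.rev_carrier]; exact τ.mem_sub_carrier _ _ _ (by linarith) ht2) ?_
      (isProj_neg hq)
    rw [GeodesicSegment.rev_target, GeodesicSegment.sub_source, dist_comm,
      τ.dist_of_le ht.1 (by linarith) ht2]
    linarith
  have q2 : -y ≤ -u - sideGap C D := by
    refine h.neg.proj_source_le
      (τ := (γ₁.sub (c + L / 2) γ₁.length (by linarith) (by linarith) le_rfl).rev)
      (by simpa using huS) (by simpa [E1] using hm)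
      (by rw [GeodesicSegment.rev_carrier]
          exact γ₁.mem_sub_carrier _ _ _ (t := c + L) (by linarith) (by linarith))
      (by rw [E2]; exact isProj_neg hq) q1
      (by rw [GeodesicSegment.rev_source, GeodesicSegment.sub_target]; exact isProj_neg hy)
  exact h.exists_mem_closedBall huS hm h23 h34 (by rw [h41]; exact hx) (by rw [← h12]; exact hy)
    p2 (by linarith)

/-- The thinness radius does not depend on the length of the thin segment, so that length can be
taken beyond the value of the gauge at this radius, finite by fullness. -/
theorem exists_abs_sub_le_of_isAntiContracting (hX : IsGeodesicSpace X) (hK : K.IsFull) :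
    ∃ W : ℝ, ∀ (x z : X) (s t : ℝ), IsAntiContracting K x z → IsProj S γ x s → IsProj S γ z t →
      t - s ≤ W := by
  set r : ℝ≥0 := ⟨thinRadius C D, h.thinRadius_pos.le⟩ with hr
  set L : ℝ := max (K.toFun r).toReal (2 * (2 * followRadius C D + C * farGap C D + C) + 1) with hL
  refine ⟨2 * (farGap C D + followGap C D) + 2 * (C * (L + 2 * followRadius C D + C)),
    fun x z s t hxz hs ht => ?_⟩
  by_contra hcon
  obtain ⟨τ, rfl, rfl⟩ := hX x z
  obtain ⟨τ', h1, h2, h3⟩ := h.exists_isThin (L := L)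
    (lt_of_lt_of_le (lt_add_one _) (le_max_right _ _)) hs ht (not_le.1 hcon).le
  refine hxz.2 r τ τ' rfl rfl h1 ?_ h3
  rw [h2, ← ENNReal.ofReal_toReal (hK r)]
  exact ENNReal.ofReal_le_ofReal (le_max_left _ _)

/-- Each move between near points shifts the projection by a bounded amount, while the path contains
parameters arbitrarily far apart. -/
theorem not_bounded (hX : IsGeodesicSpace X) (hK : K.IsFull)
    (hS : ∀ A : ℝ, ∃ s ∈ S, ∃ t ∈ S, A < |t - s|) : ¬ ∃ B : ℕ, ∀ x y : X, cdist K x y ≤ B := by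
  rintro ⟨B, hB⟩
  obtain ⟨W, hW⟩ := h.exists_abs_sub_le_of_isAntiContracting hX hK
  obtain ⟨W', hW'⟩ := h.neg.exists_abs_sub_le_of_isAntiContracting hX hK
  have hD := h.one_le_D
  have hC := h.C_pos
  set J := C * (D + 4 + C) with hJ
  have hJ0 : 0 ≤ J := by positivity
  set V := max J (max W W') with hV
  have hV0 : 0 ≤ V := hJ0.trans (le_max_left _ _)
  have anti : ∀ (x z : X) (s t : ℝ), IsAntiContracting K x z → IsProj S γ x s → IsProj S γ z t →
      |s - t| ≤ V := by
    intro x z s t hxz hs ht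
    have h1 := hW x z s t hxz hs ht
    have h2 := hW' x z _ _ hxz (isProj_neg hs) (isProj_neg ht)
    have h3 : W ≤ V := (le_max_left _ _).trans (le_max_right _ _)
    have h4 : W' ≤ V := (le_max_right _ _).trans (le_max_right _ _)
    rw [abs_le]
    constructor <;> linarith
  have near : ∀ (x z : X) (s t : ℝ), Near K x z → IsProj S γ x s → IsProj S γ z t →
      |s - t| ≤ V := by
    rintro x z s t (hxz | hxz | hxz) hs ht
    · exact (h.abs_sub_le_of_dist_le_one hxz hs ht).trans (le_max_left _ _)
    · exact anti x z s t hxz hs ht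
    · rw [abs_sub_comm]; exact anti z x t s hxz ht hs
  obtain ⟨s, hs, t, ht, hst⟩ := hS (V * B + J)
  obtain ⟨f, h0, hn, hf⟩ := exists_chain_cdist (K := K) hX (γ s) (γ t)
  have key : ∀ (n : ℕ) (t' : ℝ), IsProj S γ (f n) t' → |s - t'| ≤ V * n + J := by
    intro n
    induction n with
    | zero =>
      intro t' ht'
      have := h.abs_sub_le_of_dist_le_one (x := γ s) (by simp [h0]) (isProj_self hs) ht'
      simpa using this
    | succ n ih =>
      intro t' ht'
      obtain ⟨v, hv⟩ := h.exists_isProj (f n)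
      have h1 := ih v hv
      have h2 := near _ _ _ _ (hf n) hv ht'
      push_cast
      linarith [_root_.abs_sub_le s v t']
  have h1 := key (cdist K (γ s) (γ t)) t (by rw [hn]; exact isProj_self ht)
  have h2 : (cdist K (γ s) (γ t) : ℝ) ≤ B := by exact_mod_cast hB _ _
  have h3 := mul_le_mul_of_nonneg_left h2 hV0
  rw [abs_sub_comm] at h1
  linarith

end IsContractingPath

/-- The quasi-geodesic lower bound makes the distance to x proper on S, so a minimum exists although
X need not be proper. -/
theorem exists_closestPoint {S : Set ℝ} (hS : IsClosed S) (hne : S.Nonempty) {γ : ℝ → X}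
    (hγ : ContinuousOn γ S) {C : ℝ} (hC : 1 ≤ C)
    (hle : ∀ s ∈ S, ∀ t ∈ S, |t - s| / C - C ≤ dist (γ s) (γ t)) (x : X) :
    (closestPoints (γ '' S) x).Nonempty := by
  obtain ⟨s, hs⟩ := hne
  obtain ⟨t, ht, hmin⟩ := ContinuousOn.exists_isMinOn' (f := fun t => dist x (γ t)) (s := S)
    (by fun_prop) hS hs (by
      rw [Filter.eventually_inf_principal]
      filter_upwards [(isCompact_closedBall s (C * (2 * dist x (γ s) + C))).compl_mem_cocompact]
        with t ht htS
      simp only [mem_compl_iff, mem_closedBall, not_le, Real.dist_eq] at ht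
      have h1 := hle s hs t htS
      have h2 : 2 * dist x (γ s) + C ≤ |t - s| / C := by
        rw [le_div_iff₀ (by linarith)]; linarith
      linarith [dist_triangle_left (γ s) (γ t) x])
  refine ⟨γ t, mem_image_of_mem γ ht, le_antisymm ?_ (infDist_le_dist_of_mem (mem_image_of_mem γ ht))⟩
  rw [le_infDist ⟨_, mem_image_of_mem γ ht⟩]
  rintro _ ⟨v, hv, rfl⟩
  exact hmin hv

theorem not_bounded_of_isStronglyContractingElement (hX : IsGeodesicSpace X) (hK : K.IsFull)
    {g : X ≃ᵢ X} (hg : IsStronglyContractingElement g) :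
    ¬ ∃ B : ℕ, ∀ x y : X, cdist K x y ≤ B := by
  obtain ⟨-, C, γ, ⟨hC, hγ, hqi⟩, hcon, -⟩ := hg
  have h : IsContractingPath univ γ C C :=
    ⟨ordConnected_univ, hC, hC, fun s _ t _ => (hqi s t).1, fun s _ t _ => (hqi s t).2,
      by rwa [image_univ], exists_closestPoint isClosed_univ univ_nonempty hγ.continuousOn hC
        fun s _ t _ => (hqi s t).1⟩
  exact h.not_bounded hX hK fun A => ⟨0, trivial, |A| + 1, trivial, by
    rw [sub_zero, abs_of_nonneg (by positivity)]; linarith [le_abs_self A]⟩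

theorem not_bounded_of_hasStronglyContractingRay (hX : IsGeodesicSpace X) (hK : K.IsFull)
    (hray : HasStronglyContractingRay X) : ¬ ∃ B : ℕ, ∀ x y : X, cdist K x y ≤ B := by
  obtain ⟨α, hα, D, hD, hcon⟩ := hray
  have hdist : ∀ s ∈ Ici (0 : ℝ), ∀ t ∈ Ici (0 : ℝ),
      dist (α s.toNNReal) (α t.toNNReal) = |t - s| := fun s hs t ht => by
    rw [hα.dist_eq, NNReal.dist_eq, Real.coe_toNNReal _ hs, Real.coe_toNNReal _ ht, abs_sub_comm]
  have hle : ∀ s ∈ Ici (0 : ℝ), ∀ t ∈ Ici (0 : ℝ),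
      |t - s| / 1 - 1 ≤ dist (α s.toNNReal) (α t.toNNReal) := fun s hs t ht => by
    rw [hdist s hs t ht]; linarith
  have him : (fun t : ℝ => α t.toNNReal) '' Ici 0 = range α := by
    ext p; constructor
    · rintro ⟨t, -, rfl⟩; exact ⟨_, rfl⟩
    · rintro ⟨t, rfl⟩; exact ⟨t, t.2, by simp⟩
  have h : IsContractingPath (Ici 0) (fun t : ℝ => α t.toNNReal) 1 (D + 1) :=
    ⟨ordConnected_Ici, le_rfl, by linarith, hle,
      fun s hs t ht => by rw [hdist s hs t ht]; linarith,
      by rw [him]; exact fun x => (hcon x).trans (ENNReal.ofReal_le_ofReal (by linarith)),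
      exists_closestPoint isClosed_Ici ⟨0, by simp⟩
        (hα.continuous.comp continuous_real_toNNReal).continuousOn le_rfl hle⟩
  exact h.not_bounded hX hK fun A => ⟨0, by simp, |A| + 1, by simp; positivity, by
    rw [sub_zero, abs_of_nonneg (by positivity)]; linarith [le_abs_self A]⟩

end Contraction

/-! ### Assembly of the theorem -/

theorem mainTheorem8 (ρ : ℝ≥0) :
    ∃ Δ : ℝ, 0 < Δ ∧
      ∀ (X : Type u) [MetricSpace X], Contraction.IsGeodesicSpace X → Contraction.isomDensity X ≤ ρ →
        (∀ K : Contraction.ContractionGauge,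
          Metric.ediam (Set.univ : Set (Contraction.ContractionSpace X K)) ≤ ENNReal.ofReal Δ ∨
            ¬ Bornology.IsBounded (Set.univ : Set (Contraction.ContractionSpace X K))) ∧
        (∀ K : Contraction.ContractionGauge, K.IsFull →
          (¬ Bornology.IsBounded (Set.univ : Set (Contraction.ContractionSpace X K)) ↔
            ∃ g : X ≃ᵢ X, Contraction.IsStronglyContractingElement g) ∧
          (Contraction.HasStronglyContractingRay X →
            ¬ Bornology.IsBounded (Set.univ : Set (Contraction.ContractionSpace X K))) ∧
          (ProperSpace X →
            ¬ Bornology.IsBounded (Set.univ : Set (Contraction.ContractionSpace X K)) →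
            Contraction.HasStronglyContractingRay X)) := by
  -- The bound 4P + 201 on `cdist` for P = ⌈ρ⌉ + 2, plus 2 for points inside the glued intervals.
  refine ⟨((4 * (⌈ρ⌉₊ + 2) + 201 : ℕ) : ℝ) + 2, by positivity, fun X _ hX hρ =>
    ⟨fun K => ?_, fun K hK => ⟨⟨fun h => ?_, ?_⟩, ?_, fun _ h => ?_⟩⟩⟩
  · rw [or_iff_not_imp_right, not_not, Contraction.isBounded_contractionSpace_iff hX]
    rintro ⟨B, hB⟩
    obtain ⟨o, ho⟩ := Contraction.exists_isCoarselyDense (K := K) hX hρ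
    exact Contraction.ediam_contractionSpace_le hX (Contraction.cdist_le_of_bounded hX ho hB)
  · rw [Contraction.isBounded_contractionSpace_iff hX] at h
    obtain ⟨o, ho⟩ := Contraction.exists_isCoarselyDense (K := K) hX hρ
    obtain ⟨g, hg⟩ := Contraction.exists_isometry_add_le hX ho h
    exact ⟨g, Contraction.isStronglyContractingElement_of_isCoarseLine hX
      (Contraction.isCoarseLine_of_add_le hX hg)⟩
  · rintro ⟨g, hg⟩
    rw [Contraction.isBounded_contractionSpace_iff hX]
    exact Contraction.not_bounded_of_isStronglyContractingElement hX hK hg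
  · intro h
    rw [Contraction.isBounded_contractionSpace_iff hX]
    exact Contraction.not_bounded_of_hasStronglyContractingRay hX hK h
  · rw [Contraction.isBounded_contractionSpace_iff hX] at h
    obtain ⟨o, ho⟩ := Contraction.exists_isCoarselyDense (K := K) hX hρ
    obtain ⟨g, hg⟩ := Contraction.exists_isometry_add_le hX ho h
    exact (Contraction.isCoarseLine_of_add_le hX hg).hasStronglyContractingRay hX
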